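/- **Setting.** Let $M$ be a complete, connected, non-compact smooth Riemannian manifold with Riemannian distance $d$ and Riemannian volume measure $m$. Let $G$ be a group acting on $M$ by isometries, properly discontinuously (for every $x\in M$ and compact $K\subset M$, $gx\in K$ for only finitely many $g\in G$), cocompactly and freely. Let $c(x,y)=\vartheta(d(x,y))$ with $\vartheta:\mathbb R_+\to\mathbb R_+$ continuous, strictly increasing, $\vartheta(0)=0$, $\lim_{r\to\infty}\vartheta(r)=\infty$, and put $\mathrm{Cost}(q)=\int_{M\times M} c\,dq$ for measures $q$ on $M\times M$. A coupling of two measures on $M$ is optimal if it has least cost among all couplings of these measures. Assume that for all compactly supported Borel probability measures $\lambda\ll m$ and $\mu$ on $M$ there is a unique optimal coupling of $\lambda$ and $\mu$, and that it has the form $(\mathrm{id},T)_*\lambda$ with $T:M\to M$ measurable. Let $(\Omega,\mathfrak A,\mathbb P)$ be a probability space with a measurable action $\theta$ of $G$ that preserves $\mathbb P$. A random measure on $X=M$ or $X=M\times M$ is a measurable map $\kappa^\bullet$ from $\Omega$ to the locally finite Borel measures on $X$; it is equivariant if $\kappa^{\theta_g\omega}(gA)=\kappa^\omega(A)$ for all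 $g\in G$, $\omega\in\Omega$ and Borel $A\subset X$, where $G$ acts diagonally on $M\times M$. A fundamental region is a measurable set $F\subset M$ with $\bigcup_{g\in G}gF=M$ and $F\cap gF=\emptyset$ for $g\ne \mathrm{id}$; an admissible set is a union $\bigcup_{g\in I}gF$ with $F$ a fundamental region and $I\subset G$ finite and non-empty. Fix a fundamental region $B_0$. Let $\lambda^\bullet,\mu^\bullet$ be equivariant random measures on $M$ such that $\lambda^\omega\ll m$ for a.e. $\omega$, $\mathbb E[\lambda^\bullet(B_0)]=m(B_0)$ and $\mathbb E[\mu^\bullet(B_0)]\le m(B_0)$. A semicoupling of $\lambda^\bullet$ and $\mu^\bullet$ is a random measure $q^\bullet$ on $M\times M$ such that for a.e. $\omega$ the first marginal of $q^\omega$ is $\le\lambda^\omega$ and the second marginal equals $\mu^\omega$. Its mean transportation cost is $$\mathfrak C(q^\bullet)=\sup_{B\ \mathrm{admissible}}\frac1{m(B)}\,\mathbb E\Big[\int_{M\times B}c(x,y)\,q^\bullet(dx,dy)\Big].$$ Let $\mathfrak c_{e,\infty}$ be the infimum of $\mathfrak C$ over all equivariant semicouplings of $\lambda^\bullet$ and $\mu^\bullet$,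 and assume $\mathfrak c_{e,\infty}<\infty$. A semicoupling $q^\bullet$ is called optimal if it is equivariant and $\mathfrak C(q^\bullet)=\mathfrak c_{e,\infty}$. **Theorem.** Every optimal semicoupling $q^\bullet$ of $\lambda^\bullet$ and $\mu^\bullet$ is locally optimal, that is, for $\mathbb P$-a.e. $\omega$ all of the following hold: 1. for each bounded Borel set $A\subset M$, the measure $1_{M\times A}\,q^\omega$ is the unique optimal coupling of $q^\omega(\cdot\times A)$ and $1_A\mu^\omega$; 2. the support of $q^\omega$ is $c$-cyclically monotone, i.e. $\sum_{i=1}^N c(x_i,y_i)\le\sum_{i=1}^N c(x_i,y_{i+1})$ (with $y_{N+1}=y_1$) for all $N\ge 1$ and all $(x_1,y_1),\dots,(x_N,y_N)$ in the support; 3. there are a measurable density $\rho:M\to[0,\infty)$ and a measurable map $T:M\to M$ such that the closure of $\{(x,T(x)):\rho(x)>0\}$ is $c$-cyclically monotone and $q^\omega=(\mathrm{id},T)_*(\rho\,\lambda^\omega)$. -/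

import Mathlib

open MeasureTheory ProbabilityTheory Set Filter Topology Bundle Manifold
open scoped NNReal ENNReal ContDiff Pointwise

noncomputable section

/-! ### Group actions -/

/-- The action of `G` on `M` is properly discontinuous: every orbit map hits every compact set for
only finitely many group elements. -/
def IsProperlyDiscontinuous (G M : Type*) [SMul G M] [TopologicalSpace M] : Prop :=
  ∀ (x : M) (K : Set M), IsCompact K → {g : G | g • x ∈ K}.Finite

/-- The action of `G` on `M` is cocompact: the quotient `M / G` is compact. -/
def IsCocompactAction (G M : Type*) [Group G] [MulAction G M] [TopologicalSpace M] : Prop :=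
  CompactSpace (Quotient (MulAction.orbitRel G M))

/-- The action of `G` on `M` is free: all stabilizers are trivial. -/
def IsFreeAction (G M : Type*) [Group G] [MulAction G M] : Prop :=
  ∀ (x : M) (g : G), g • x = x → g = 1

/-- A fundamental region: a measurable set whose translates tile `M`. -/
structure IsFundamentalRegion (G : Type*) {M : Type*} [Group G] [MulAction G M]
    [MeasurableSpace M] (F : Set M) : Prop where
  measurableSet : MeasurableSet F
  iUnion_eq : ⋃ g : G, g • F = univ
  disjoint : ∀ g : G, g ≠ 1 → Disjoint F (g • F)

/-- The admissible sets: unions of finitely many, at least one, translates of a fundamental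
region. -/
def IsAdmissible (G : Type*) {M : Type*} [Group G] [MulAction G M] [MeasurableSpace M]
    (B : Set M) : Prop :=
  ∃ (I : Finset G) (F : Set M), I.Nonempty ∧ IsFundamentalRegion G F ∧ B = ⋃ g ∈ I, g • F

/-! ### Couplings of deterministic measures -/

/-- `q` is a semicoupling of `lam` and `mu`. -/
def IsSemicoupling {X : Type*} [MeasurableSpace X] (lam mu : Measure X) (q : Measure (X × X)) :
    Prop :=
  q.fst ≤ lam ∧ q.snd = mu

/-- `q` is a coupling of `lam` and `mu`. -/
def IsCoupling {X : Type*} [MeasurableSpace X] (lam mu : Measure X) (q : Measure (X × X)) :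
    Prop :=
  q.fst = lam ∧ q.snd = mu

/-- The cost functional `∫ c(x, y) q(dx, dy)`. -/
def transportCost {X : Type*} [MeasurableSpace X] (c : X → X → ℝ≥0) (q : Measure (X × X)) :
    ℝ≥0∞ :=
  ∫⁻ p, (c p.1 p.2 : ℝ≥0∞) ∂q

/-- `q` is an optimal coupling of `lam` and `mu`. -/
def IsOptimalCoupling {X : Type*} [MeasurableSpace X] (c : X → X → ℝ≥0) (lam mu : Measure X)
    (q : Measure (X × X)) : Prop :=
  IsCoupling lam mu q ∧ ∀ q', IsCoupling lam mu q' → transportCost c q ≤ transportCost c q'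

/-- `q` is the unique optimal coupling of `lam` and `mu`. -/
def IsUniqueOptimalCoupling {X : Type*} [MeasurableSpace X] (c : X → X → ℝ≥0)
    (lam mu : Measure X) (q : Measure (X × X)) : Prop :=
  IsOptimalCoupling c lam mu q ∧ ∀ q', IsOptimalCoupling c lam mu q' → q' = q

/-- For the reference measure `m`, the optimal transport problem between any two compactly
supported probability measures, the first one absolutely continuous, has a unique solution, and
this solution is induced by a measurable map. -/
def MongeUniquelySolvable {X : Type*} [TopologicalSpace X] [MeasurableSpace X] (m : Measure X)
    (c : X → X → ℝ≥0) : Prop :=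
  ∀ lam mu : Measure X, IsProbabilityMeasure lam → IsProbabilityMeasure mu →
    (∃ K, IsCompact K ∧ lam Kᶜ = 0) → (∃ K, IsCompact K ∧ mu Kᶜ = 0) → lam ≪ m →
    ∃ q : Measure (X × X), IsUniqueOptimalCoupling c lam mu q ∧
      ∃ T : X → X, Measurable T ∧ q = lam.map (fun x => (x, T x))

/-- `S` is `c`-cyclically monotone. The indices are cyclic: in `Fin (N + 1)` the successor of the
last element is `0`. -/
def IsCyclicallyMonotone {X : Type*} (c : X → X → ℝ≥0) (S : Set (X × X)) : Prop :=
  ∀ (N : ℕ) (z : Fin (N + 1) → X × X), (∀ i, z i ∈ S) →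
    ∑ i, c (z i).1 (z i).2 ≤ ∑ i, c (z i).1 (z (i + 1)).2

/-! ### Random measures -/

/-- A random measure: a measurable map from `Ω` to the measures on `X` all of whose values are
locally finite. -/
def IsRandomMeasure {Ω X : Type*} [MeasurableSpace Ω] [TopologicalSpace X] [MeasurableSpace X]
    (κ : Kernel Ω X) : Prop :=
  ∀ w, IsLocallyFiniteMeasure (κ w)

/-- Equivariance: `κ (g • w) (g • A) = κ w A` for all `g`, `w` and `A`. On `X = M × M` the group
acts diagonally. -/
def IsEquivariant (G : Type*) {Ω X : Type*} [SMul G Ω] [SMul G X] [MeasurableSpace Ω]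
    [MeasurableSpace X] (κ : Kernel Ω X) : Prop :=
  ∀ (g : G) (w : Ω), κ (g • w) = (κ w).map (fun x => g • x)

/-- `q` is an equivariant semicoupling of the random measures `lam` and `mu`. -/
structure IsEquivariantSemicoupling (G : Type*) {Ω M : Type*} [SMul G Ω] [SMul G M]
    [MeasurableSpace Ω] [TopologicalSpace M] [MeasurableSpace M] (P : Measure Ω)
    (lam mu : Kernel Ω M) (q : Kernel Ω (M × M)) : Prop where
  isRandomMeasure : IsRandomMeasure q
  isSemicoupling : ∀ᵐ w ∂P, IsSemicoupling (lam w) (mu w) (q w)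
  isEquivariant : IsEquivariant G q

/-- The mean transportation cost
`sup_B m(B)⁻¹ E[∫_{M × B} c(x, y) q(dx, dy)]` over all admissible sets `B`. -/
def meanTransportCost (G : Type*) {Ω M : Type*} [Group G] [MulAction G M] [MeasurableSpace Ω]
    [MeasurableSpace M] (P : Measure Ω) (m : Measure M) (c : M → M → ℝ≥0)
    (q : Kernel Ω (M × M)) : ℝ≥0∞ :=
  ⨆ (B : Set M) (_ : IsAdmissible G B),
    (m B)⁻¹ * ∫⁻ w, transportCost c ((q w).restrict (univ ×ˢ B)) ∂P

/-- The optimal mean transportation cost: the infimum over all equivariant semicouplings. -/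
def optimalMeanTransportCost (G : Type*) {Ω M : Type*} [Group G] [MulAction G M] [SMul G Ω]
    [MeasurableSpace Ω] [TopologicalSpace M] [MeasurableSpace M] (P : Measure Ω) (m : Measure M)
    (c : M → M → ℝ≥0) (lam mu : Kernel Ω M) : ℝ≥0∞ :=
  ⨅ (q : Kernel Ω (M × M)) (_ : IsEquivariantSemicoupling G P lam mu q),
    meanTransportCost G P m c q

/-- An optimal semicoupling of random measures: equivariant and asymptotically optimal. -/
structure IsOptimalSemicoupling (G : Type*) {Ω M : Type*} [Group G] [MulAction G M] [SMul G Ω]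
    [MeasurableSpace Ω] [TopologicalSpace M] [MeasurableSpace M] (P : Measure Ω) (m : Measure M)
    (c : M → M → ℝ≥0) (lam mu : Kernel Ω M) (q : Kernel Ω (M × M)) : Prop where
  isEquivariantSemicoupling : IsEquivariantSemicoupling G P lam mu q
  asymptotically_optimal :
    meanTransportCost G P m c q = optimalMeanTransportCost G P m c lam mu

/-- The three properties that describe local optimality of a semicoupling `q` of deterministic
measures `lam` and `mu`. -/
structure IsLocallyOptimalAt {M : Type*} [MetricSpace M] [MeasurableSpace M]
    (c : M → M → ℝ≥0) (lam mu : Measure M) (q : Measure (M × M)) : Prop where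
  /-- On every bounded target set `A`, the restriction of `q` is the unique optimal coupling of
  `q(· × A)` and `1_A mu`. -/
  unique_optimal : ∀ A : Set M, Bornology.IsBounded A → MeasurableSet A →
    IsUniqueOptimalCoupling c (q.restrict (univ ×ˢ A)).fst (mu.restrict A)
      (q.restrict (univ ×ˢ A))
  /-- The support of `q` is `c`-cyclically monotone. -/
  cyclically_monotone : IsCyclicallyMonotone c q.support
  /-- `q` is induced by a density and a `c`-cyclically monotone map. -/
  induced_by_map : ∃ (ρ : M → ℝ≥0) (T : M → M), Measurable ρ ∧ Measurable T ∧
    IsCyclicallyMonotone c (closure {p : M × M | 0 < ρ p.1 ∧ p.2 = T p.1}) ∧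
    q = (lam.withDensity (fun x => (ρ x : ℝ≥0∞))).map (fun x => (x, T x))

/-- Local optimality of a semicoupling of random measures. -/
def IsLocallyOptimal {Ω M : Type*} [MeasurableSpace Ω] [MetricSpace M] [MeasurableSpace M]
    (P : Measure Ω) (c : M → M → ℝ≥0) (lam mu : Kernel Ω M) (q : Kernel Ω (M × M)) : Prop :=
  ∀ᵐ w ∂P, IsLocallyOptimalAt c (lam w) (mu w) (q w)

end

/-! Optimality of `q` concerns a mean cost, whereas local optimality is a statement about single
realisations. Cyclical monotonicity of the support links the two.

From mean to pointwise. If the support of `q w` is not cyclically monotone, continuity of the cost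
gives finitely many basic open boxes `U i ×ˢ V i` of positive mass such that shifting mass from `U i
×ˢ V i` to `U i ×ˢ V (i + 1)` saves a uniform amount per unit of mass. Only countably many such
families of boxes are needed, so failure with positive probability makes one family work with
positive probability. The exchange is then carried out in all translates of the boxes at once.
Proper discontinuity bounds by some `L` the number of translates that can overlap over a point; if
each exchange removes at most the fraction `1 / L` of `q`, the superposition removes at most `q`.
The result is equivariant and has the same marginals. By the Campbell formula its expected cost on a
fundamental region changes by the expected saving of one exchange, which contradicts optimality
(`exists_expectedCost_lt`, `IsOptimalSemicoupling.ae_isCyclicallyMonotone_support`).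

From monotone to locally optimal. Rüschendorf's potentials show that a finite measure with
cyclically monotone support is optimal for its marginals (`IsCyclicallyMonotone.transportCost_le`).
The Monge hypothesis then forces a locally finite one with absolutely continuous first marginal onto
a graph. If `q'` is another optimal coupling, `q + q'` is optimal as well, hence has monotone
support and lives on a single graph, so `q' = q` (`MongeUniquelySolvable.isUniqueOptimalCoupling`).
Density and map come from `q.fst` and this graph (`isLocallyOptimalAt_of_isCyclicallyMonotone`).

The geometry supplies what these arguments need: cocompactness and the length property make `M`
proper, hence `G` is countable and fundamental regions have finite volume. -/

/-! ### Riemannian manifolds -/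

section Riemannian

variable {n : ℕ} {M : Type*} [MetricSpace M] [ChartedSpace (EuclideanSpace ℝ (Fin n)) M]
  [RiemannianBundle (fun x : M => TangentSpace (𝓡 n) x)]

/-- The distance on a Riemannian manifold is a length distance. -/
theorem exists_dist_eq_of_isRiemannianManifold [IsRiemannianManifold (𝓡 n) M] (x y : M) {s ε : ℝ}
    (hs : 0 ≤ s) (hsd : s ≤ dist x y) (hε : 0 < ε) :
    ∃ z, dist x z = s ∧ dist z y < dist x y - s + ε := by
  have h1 : riemannianEDist (𝓡 n) x y < ENNReal.ofReal (dist x y + ε) := by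
    rw [← IsRiemannianManifold.out (I := 𝓡 n), edist_dist]
    exact (ENNReal.ofReal_lt_ofReal_iff (by positivity)).2 (by linarith)
  obtain ⟨γ, h0, hγ1, hγ, hlen⟩ := exists_lt_of_riemannianEDist_lt h1
  have hcont : ContinuousOn (fun t => dist x (γ t)) (Icc 0 1) :=
    (continuous_const.dist continuous_id).comp_continuousOn hγ.continuousOn
  -- An almost shortest path passes through a point at distance `s` from `x`; its two pieces have
  -- total length less than `dist x y + ε`.
  obtain ⟨t, ht, hts⟩ := intermediate_value_Icc zero_le_one hcont
    (show s ∈ Icc (dist x (γ 0)) (dist x (γ 1)) by simp [h0, hγ1, hs, hsd])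
  refine ⟨γ t, hts, ?_⟩
  have e1 : edist x (γ t) ≤ pathELength (𝓡 n) γ 0 t := by
    rw [IsRiemannianManifold.out (I := 𝓡 n)]
    exact riemannianEDist_le_pathELength (hγ.mono (Icc_subset_Icc_right ht.2)) h0 rfl ht.1
  have e2 : edist (γ t) y ≤ pathELength (𝓡 n) γ t 1 := by
    rw [IsRiemannianManifold.out (I := 𝓡 n)]
    exact riemannianEDist_le_pathELength (hγ.mono (Icc_subset_Icc_left ht.1)) rfl hγ1 ht.2
  have e3 := (add_le_add e1 e2).trans_lt ((pathELength_add ht.1 ht.2).trans_lt hlen)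
  rw [edist_dist, edist_dist, ← ENNReal.ofReal_add dist_nonneg dist_nonneg,
    ENNReal.ofReal_lt_ofReal_iff (by positivity)] at e3
  simp only at hts
  linarith

section

variable [IsManifold (𝓡 n) ∞ M] [IsContMDiffRiemannianBundle (𝓡 n) ∞ (EuclideanSpace ℝ (Fin n))
  (fun x : M => TangentSpace (𝓡 n) x)]

/-- Near the base point, the derivative of the inverse of a chart is bounded. -/
theorem eventually_enorm_mfderivWithin_extChartAt_symm_le (x : M) :
    ∃ C : ℝ≥0, ∀ᶠ y in 𝓝[range (𝓡 n)] (extChartAt (𝓡 n) x x), ∀ v : EuclideanSpace ℝ (Fin n),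
      ‖mfderivWithin (𝓡 n) (𝓡 n) (extChartAt (𝓡 n) x).symm (range (𝓡 n)) y v‖ₑ ≤ C * ‖v‖ₑ := by
  have : IsContinuousRiemannianBundle (EuclideanSpace ℝ (Fin n))
      (fun x : M => TangentSpace (𝓡 n) x) := by
    obtain ⟨g, hg, hg'⟩ := IsContMDiffRiemannianBundle.exists_contMDiff (IB := 𝓡 n) (n := ∞)
      (F := EuclideanSpace ℝ (Fin n)) (E := fun x : M => TangentSpace (𝓡 n) x)
    exact ⟨g, hg.continuous, hg'⟩
  rcases eventually_enorm_mfderivWithin_symm_extChartAt_lt (𝓡 n) x with ⟨C, C_pos, hC⟩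
  refine ⟨C, hC.mono fun y hy v => ?_⟩
  exact le_trans (ContinuousLinearMap.le_opENorm _ v) (mul_le_mul' hy.le le_rfl)

/-- The inverses of the charts are locally Lipschitz for the Riemannian distance. -/
theorem exists_lipschitzOnWith_extChartAt_symm [IsRiemannianManifold (𝓡 n) M] (x : M) :
    ∃ C : ℝ≥0, ∃ r > 0, Metric.ball (extChartAt (𝓡 n) x x) r ⊆ (extChartAt (𝓡 n) x).target ∧
      LipschitzOnWith C (extChartAt (𝓡 n) x).symm (Metric.ball (extChartAt (𝓡 n) x x) r) := by
  obtain ⟨C, hC⟩ := eventually_enorm_mfderivWithin_extChartAt_symm_le (n := n) x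
  obtain ⟨r, r_pos, hr⟩ : ∃ r > 0,
      Metric.ball (extChartAt (𝓡 n) x x) r ∩ range (𝓡 n) ⊆ (extChartAt (𝓡 n) x).target ∩
        {y | ∀ v : EuclideanSpace ℝ (Fin n),
          ‖mfderivWithin (𝓡 n) (𝓡 n) (extChartAt (𝓡 n) x).symm (range (𝓡 n)) y v‖ₑ ≤ C * ‖v‖ₑ} :=
    Metric.mem_nhdsWithin_iff.1 (inter_mem (extChartAt_target_mem_nhdsWithin x) hC)
  have hrange : range (𝓡 n) = univ := ModelWithCorners.range_eq_univ _
  refine ⟨C, r, r_pos, fun y hy => (hr ⟨hy, by simp⟩).1, fun y hy z hz => ?_⟩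
  rw [IsRiemannianManifold.out (I := 𝓡 n)]
  -- The segment from `y` to `z` stays in the ball, so its image is a path of length at most `C`
  -- times the Euclidean distance.
  let η := ContinuousAffineMap.lineMap (R := ℝ) y z
  set γ := (extChartAt (𝓡 n) x).symm ∘ η
  have hη : Icc 0 1 ⊆ ⇑η ⁻¹' ((extChartAt (𝓡 n) x).target ∩
        {y | ∀ v : EuclideanSpace ℝ (Fin n),
          ‖mfderivWithin (𝓡 n) (𝓡 n) (extChartAt (𝓡 n) x).symm (range (𝓡 n)) y v‖ₑ ≤ C * ‖v‖ₑ}) := by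
    simp only [← image_subset_iff, ContinuousAffineMap.coe_lineMap_eq,
     ← segment_eq_image_lineMap, η]
    apply Subset.trans _ hr
    rw [hrange, inter_univ]
    exact (convex_ball _ _).segment_subset hy hz
  simp only [preimage_inter, subset_inter_iff] at hη
  have η_smooth : ContMDiffOn 𝓘(ℝ, ℝ) 𝓘(ℝ, EuclideanSpace ℝ (Fin n)) 1 η (Icc 0 1) := by
    apply ContMDiff.contMDiffOn
    rw [contMDiff_iff_contDiff]
    exact ContinuousAffineMap.contDiff _
  have : riemannianEDist (𝓡 n) ((extChartAt (𝓡 n) x).symm y) ((extChartAt (𝓡 n) x).symm z)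
      ≤ pathELength (𝓡 n) γ 0 1 := by
    apply riemannianEDist_le_pathELength _ _ _ zero_le_one
    · exact (contMDiffOn_extChartAt_symm x).comp η_smooth hη.1
    · simp [γ, η, ContinuousAffineMap.coe_lineMap_eq]
    · simp [γ, η, ContinuousAffineMap.coe_lineMap_eq]
  apply this.trans
  rw [← lintegral_fderiv_lineMap_eq_edist, pathELength_eq_lintegral_mfderivWithin_Icc,
    ← lintegral_const_mul' _ _ ENNReal.coe_ne_top]
  apply setLIntegral_mono' measurableSet_Icc (fun t ht ↦ ?_)
  have : mfderivWithin 𝓘(ℝ, ℝ) (𝓡 n) γ (Icc 0 1) t =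
      (mfderivWithin 𝓘(ℝ, EuclideanSpace ℝ (Fin n)) (𝓡 n)
        (extChartAt (𝓡 n) x).symm (range (𝓡 n)) (η t)) ∘L
      (mfderivWithin 𝓘(ℝ, ℝ) 𝓘(ℝ, EuclideanSpace ℝ (Fin n)) η (Icc 0 1) t) := by
    apply mfderivWithin_comp
    · exact mdifferentiableWithinAt_extChartAt_symm (hη.1 ht)
    · exact η_smooth.mdifferentiableOn one_ne_zero t ht
    · exact hη.1.trans (preimage_mono (extChartAt_target_subset_range x))
    · rw [uniqueMDiffWithinAt_iff_uniqueDiffWithinAt]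
      exact uniqueDiffOn_Icc zero_lt_one t ht
  have : mfderivWithin 𝓘(ℝ, ℝ) (𝓡 n) γ (Icc 0 1) t 1 =
      (mfderivWithin 𝓘(ℝ, EuclideanSpace ℝ (Fin n)) (𝓡 n)
        (extChartAt (𝓡 n) x).symm (range (𝓡 n)) (η t))
      (mfderivWithin 𝓘(ℝ, ℝ) 𝓘(ℝ, EuclideanSpace ℝ (Fin n)) η (Icc 0 1) t 1) := congr($this 1)
  rw [this]
  refine (hη.2 ht _).trans ?_
  gcongr
  simp only [mfderivWithin_eq_fderivWithin]
  exact le_of_eq rfl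

/-- A point has a neighbourhood that is a Lipschitz image of a Euclidean ball. Such a map increases
Hausdorff measure by a bounded factor, and the ball has finite Hausdorff measure because Lebesgue
measure is a nonzero multiple of it. -/
theorem isLocallyFiniteMeasure_euclideanHausdorffMeasure [IsRiemannianManifold (𝓡 n) M]
    [MeasurableSpace M] [BorelSpace M] :
    IsLocallyFiniteMeasure (μHE[n] : Measure M) := by
  refine ⟨fun x => ?_⟩
  obtain ⟨C, r, hr, hsub, hC⟩ := exists_lipschitzOnWith_extChartAt_symm (n := n) x
  refine ⟨(extChartAt (𝓡 n) x).symm '' Metric.ball (extChartAt (𝓡 n) x x) r, ?_, ?_⟩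
  · have h1 : (extChartAt (𝓡 n) x).source ∩
        extChartAt (𝓡 n) x ⁻¹' Metric.ball (extChartAt (𝓡 n) x x) r ∈ 𝓝 x :=
      inter_mem (extChartAt_source_mem_nhds x)
        ((continuousAt_extChartAt x).preimage_mem_nhds (Metric.ball_mem_nhds _ hr))
    filter_upwards [h1] with y hy
    exact ⟨_, hy.2, (extChartAt (𝓡 n) x).left_inv hy.1⟩
  · have hE : (μH[n] : Measure (EuclideanSpace ℝ (Fin n)))
        (Metric.ball (extChartAt (𝓡 n) x x) r) < ⊤ := by
      have h := measure_ball_lt_top (μ := (volume : Measure (EuclideanSpace ℝ (Fin n))))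
        (x := extChartAt (𝓡 n) x x) (r := r)
      rw [← EuclideanSpace.euclideanHausdorffMeasure_eq_volume,
        Measure.euclideanHausdorffMeasure_def, Measure.smul_apply, ENNReal.smul_def,
        smul_eq_mul] at h
      refine lt_top_iff_ne_top.2 fun h' => ?_
      rw [h', ENNReal.mul_top] at h
      · exact lt_irrefl _ h
      · simpa using Measure.addHaarScalarFactor_volume_hausdorffMeasure_ne_zero n
    rw [Measure.euclideanHausdorffMeasure_def, Measure.smul_apply, ENNReal.smul_def, smul_eq_mul]
    refine ENNReal.mul_lt_top ENNReal.coe_lt_top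
      ((hC.hausdorffMeasure_image_le (Nat.cast_nonneg n)).trans_lt ?_)
    refine ENNReal.mul_lt_top ?_ hE
    simp

end

end Riemannian

/-! ### Properness of the space, and orbits in compact sets -/

section Proper

variable {M : Type*} [MetricSpace M]

/-- A length space all of whose closed balls of one fixed radius are compact is proper. -/
theorem properSpace_of_isCompact_closedBall {r : ℝ} (hr : 0 < r)
    (hc : ∀ x : M, IsCompact (Metric.closedBall x r))
    (hlen : ∀ (x y : M) (s ε : ℝ), 0 ≤ s → s ≤ dist x y → 0 < ε →
      ∃ z, dist x z = s ∧ dist z y < dist x y - s + ε) : ProperSpace M := by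
  -- Radii grow by `r / 2`. A point of the larger ball is within `r / 2 + r / 4` of some `w` in the
  -- smaller one, and `w` is within `r / 4` of a centre of a finite cover; so finitely many compact
  -- `r`-balls cover the larger ball.
  have key : ∀ (k : ℕ) (x : M), IsCompact (Metric.closedBall x (k * (r / 2))) := by
    intro k
    induction k with
    | zero => intro x; simp
    | succ k ih =>
      intro x
      obtain ⟨t, -, htf, ht⟩ := (ih x).finite_cover_balls (show 0 < r / 4 by positivity)
      refine (htf.isCompact_biUnion fun z _ => hc z).of_isClosed_subset
        Metric.isClosed_closedBall fun y hy => ?_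
      rw [Metric.mem_closedBall, dist_comm] at hy
      push_cast at hy
      obtain ⟨w, hw1, hw2⟩ : ∃ w ∈ Metric.closedBall x (k * (r / 2)), dist w y < 3 * r / 4 := by
        rcases le_total (dist x y) (k * (r / 2)) with h | h
        · exact ⟨y, by simpa [dist_comm] using h, by simpa using by positivity⟩
        · obtain ⟨z, hz1, hz2⟩ := hlen x y _ (r / 4) (by positivity) h (by positivity)
          exact ⟨z, by rw [Metric.mem_closedBall, dist_comm, hz1], by linarith⟩
      obtain ⟨z, hz, hwz⟩ := mem_iUnion₂.1 (ht hw1)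
      refine mem_iUnion₂.2 ⟨z, hz, ?_⟩
      rw [Metric.mem_ball] at hwz
      rw [Metric.mem_closedBall]
      have := dist_triangle y w z
      rw [dist_comm y w] at this
      linarith
  refine ⟨fun x R => ?_⟩
  obtain ⟨k, hk⟩ := exists_nat_ge (R / (r / 2))
  refine (key k x).of_isClosed_subset Metric.isClosed_closedBall
    (Metric.closedBall_subset_closedBall ?_)
  rwa [div_le_iff₀ (by positivity)] at hk

variable {G : Type*} [Group G] [MulAction G M]

theorem IsProperlyDiscontinuous.countable [ProperSpace M] [Nonempty M]
    (hdisc : IsProperlyDiscontinuous G M) : Countable G := by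
  obtain ⟨x⟩ := ‹Nonempty M›
  have : (univ : Set G) = ⋃ k : ℕ, {g : G | g • x ∈ Metric.closedBall x k} := by
    refine (eq_univ_of_forall fun g => ?_).symm
    obtain ⟨k, hk⟩ := exists_nat_ge (dist (g • x) x)
    exact mem_iUnion.2 ⟨k, hk⟩
  rw [← countable_univ_iff, this]
  exact countable_iUnion fun k => (hdisc x _ (isCompact_closedBall x k)).countable

variable [IsIsometricSMul G M]

/-- The quotient map is open, so finitely many interiors of compact neighbourhoods already project
onto the compact quotient. -/
theorem exists_isCompact_iUnion_smul_eq_univ [LocallyCompactSpace M]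
    (hcocompact : IsCocompactAction G M) :
    ∃ K : Set M, IsCompact K ∧ ⋃ g : G, g • K = univ := by
  have : CompactSpace (Quotient (MulAction.orbitRel G M)) := hcocompact
  have hopen : IsOpenMap (Quotient.mk (MulAction.orbitRel G M)) := isOpenMap_quotient_mk'_mul
  choose K hK hxK using fun x : M => exists_compact_mem_nhds x
  obtain ⟨t, ht⟩ := isCompact_univ.elim_finite_subcover
    (fun x : M => Quotient.mk (MulAction.orbitRel G M) '' interior (K x))
    (fun x => hopen _ isOpen_interior) (fun p _ => by
      obtain ⟨x, rfl⟩ := Quotient.exists_rep p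
      exact mem_iUnion.2 ⟨x, _, mem_interior_iff_mem_nhds.2 (hxK x), rfl⟩)
  refine ⟨⋃ x ∈ t, K x, t.isCompact_biUnion fun x _ => hK x, eq_univ_of_forall fun y => ?_⟩
  obtain ⟨x, hx, z, hz, hzy⟩ := mem_iUnion₂.1 (ht (mem_univ (Quotient.mk _ y)))
  obtain ⟨g, hg⟩ : y ∈ MulAction.orbit G z :=
    (MulAction.orbitRel_apply).1 (Quotient.exact hzy.symm)
  exact mem_iUnion.2 ⟨g, z, mem_iUnion₂.2 ⟨x, hx, interior_subset hz⟩, hg⟩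

/-- A compact set has a thickening with compact closure; isometries carry its radius from the
compact `K` to all of `M`. -/
theorem exists_isCompact_closedBall_of_isCocompactAction [LocallyCompactSpace M]
    (hcocompact : IsCocompactAction G M) :
    ∃ r > 0, ∀ x : M, IsCompact (Metric.closedBall x r) := by
  obtain ⟨K, hK, hcov⟩ := exists_isCompact_iUnion_smul_eq_univ (G := G) hcocompact
  obtain ⟨L, hL, hKL⟩ := exists_compact_superset hK
  obtain ⟨δ, hδ, hsub⟩ := hK.exists_cthickening_subset_open isOpen_interior hKL
  refine ⟨δ, hδ, fun x => ?_⟩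
  obtain ⟨g, y, hy, rfl⟩ := mem_iUnion.1 (hcov.symm ▸ mem_univ x : x ∈ ⋃ g : G, g • K)
  have h1 : IsCompact (Metric.closedBall y δ) :=
    hL.of_isClosed_subset Metric.isClosed_closedBall
      (((Metric.closedBall_subset_cthickening hy δ).trans hsub).trans interior_subset)
  simp only [← Metric.smul_closedBall]
  exact h1.smul g

/-- A properly discontinuous isometric action on a proper space moves a compact set off itself, up
to finitely many group elements. -/
theorem IsProperlyDiscontinuous.finite_inter_nonempty [ProperSpace M]
    (hdisc : IsProperlyDiscontinuous G M) {K : Set M} (hK : IsCompact K) :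
    {g : G | (g • K ∩ K).Nonempty}.Finite := by
  rcases K.eq_empty_or_nonempty with rfl | ⟨x, hx⟩
  · simp
  -- If `y` and `g • y` lie in `K`, then `g • x` is within `diam K` of `g • y`. This reduces the
  -- claim to the orbit of the single point `x`.
  refine (hdisc x (Metric.cthickening (Metric.diam K) K) hK.cthickening).subset ?_
  rintro g ⟨_, ⟨y, hy, rfl⟩, hgy⟩
  refine Metric.mem_cthickening_of_dist_le _ (g • y) _ _ hgy ?_
  rw [dist_smul]
  exact Metric.dist_le_diam_of_mem hK.isBounded hx hy

/-- A compact set meets every orbit in a bounded number of points. -/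
theorem IsProperlyDiscontinuous.exists_tsum_indicator_le [ProperSpace M]
    (hdisc : IsProperlyDiscontinuous G M) {K : Set M} (hK : IsCompact K) :
    ∃ N : ℕ, 0 < N ∧ ∀ x : M, ∑' g : G, K.indicator (fun _ => (1 : ℝ≥0∞)) (g • x) ≤ N := by
  classical
  have hfin := hdisc.finite_inter_nonempty hK
  -- Adding one keeps the bound positive even for empty `K`; it is later inverted.
  refine ⟨hfin.toFinset.card + 1, Nat.succ_pos _, fun x => ?_⟩
  by_cases hx : ∃ h : G, h • x ∈ K
  · obtain ⟨h, hh⟩ := hx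
    -- Reindexing moves the base point to `h • x ∈ K`, after which only `g` with `g • K` meeting `K`
    -- contribute.
    rw [← (Equiv.mulRight h).tsum_eq, tsum_eq_sum (s := hfin.toFinset)]
    · refine (Finset.sum_le_card_nsmul _ _ 1 fun g _ => ?_).trans ?_
      · exact indicator_le (fun _ _ => le_rfl) _
      · simp
    · intro g hg
      refine indicator_of_notMem (fun hgx => hg ?_) _
      rw [Set.Finite.mem_toFinset]
      exact ⟨_, ⟨h • x, hh, rfl⟩, by simpa [mul_smul] using hgx⟩
  · push Not at hx
    simp [indicator_of_notMem (hx _)]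

end Proper

/-! ### Cyclic exchanges -/

section Exchange

variable {X : Type*}

theorem IsCyclicallyMonotone.mono {c : X → X → ℝ≥0} {S T : Set (X × X)}
    (hT : IsCyclicallyMonotone c T) (h : S ⊆ T) : IsCyclicallyMonotone c S :=
  fun N z hz => hT N z fun i => h (hz i)

/-- The cyclic shift of mass from `U i × V i` to `U i × V (i + 1)` lowers the cost, by a margin that
is uniform over the points of these sets. -/
def IsCyclicViolation (c : X → X → ℝ≥0) {N : ℕ} (U V : Fin (N + 1) → Set X) : Prop :=
  ∃ α β : Fin (N + 1) → ℝ≥0, ∑ i, β i < ∑ i, α i ∧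
    (∀ i, ∀ x ∈ U i, ∀ y ∈ V i, α i ≤ c x y) ∧ ∀ i, ∀ x ∈ U i, ∀ y ∈ V (i + 1), c x y ≤ β i

/-- The failed inequality is strict and has finitely many terms, so by continuity it persists, with
a margin, on small basic neighbourhoods. -/
theorem exists_isCyclicViolation [TopologicalSpace X] {c : X → X → ℝ≥0}
    (hc : Continuous fun p : X × X => c p.1 p.2) {b : Set (Set X)}
    (hb : TopologicalSpace.IsTopologicalBasis b) {S : Set (X × X)}
    (hS : ¬ IsCyclicallyMonotone c S) :
    ∃ (N : ℕ) (z : Fin (N + 1) → X × X) (U V : Fin (N + 1) → Set X), (∀ i, z i ∈ S) ∧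
      (∀ i, U i ∈ b ∧ V i ∈ b ∧ (z i).1 ∈ U i ∧ (z i).2 ∈ V i) ∧ IsCyclicViolation c U V := by
  unfold IsCyclicallyMonotone at hS
  push Not at hS
  obtain ⟨N, z, hzS, hlt⟩ := hS
  obtain ⟨ε, hε, hgap⟩ : ∃ ε : ℝ≥0, 0 < ε ∧
      ∑ i, c (z i).1 (z (i + 1)).2 + 2 * (N + 1) * ε < ∑ i, c (z i).1 (z i).2 := by
    obtain ⟨δ, hδ⟩ := exists_add_of_le hlt.le
    have hδ0 : 0 < δ := by
      rcases eq_or_ne δ 0 with rfl | h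
      · simp [hδ] at hlt
      · exact pos_iff_ne_zero.2 h
    -- Each of the `2 * (N + 1)` cost terms may move by `ε`, which uses up half of the gap `δ`.
    refine ⟨δ / (4 * (N + 1)), by positivity, ?_⟩
    rw [hδ]
    have : 2 * (N + 1) * (δ / (4 * (N + 1))) = δ / 2 := by field_simp; norm_num
    rw [this]
    gcongr
    exact half_lt_self hδ0
  have h1 : ∀ i, ∃ A ∈ 𝓝 (z i).1, ∃ B ∈ 𝓝 (z i).2, ∀ x ∈ A, ∀ y ∈ B,
      c (z i).1 (z i).2 ≤ c x y + ε := by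
    intro i
    have h : ∀ᶠ p : X × X in 𝓝 (z i), c (z i).1 (z i).2 < c p.1 p.2 + ε :=
      (hc.add continuous_const).continuousAt.eventually_const_lt
        (lt_add_of_pos_right _ hε)
    obtain ⟨A, hA, B, hB, hAB⟩ := mem_nhds_prod_iff.1 h
    exact ⟨A, hA, B, hB, fun x hx y hy => (hAB (mk_mem_prod hx hy)).le⟩
  have h2 : ∀ i, ∃ A ∈ 𝓝 (z i).1, ∃ B ∈ 𝓝 (z (i + 1)).2, ∀ x ∈ A, ∀ y ∈ B,
      c x y ≤ c (z i).1 (z (i + 1)).2 + ε := by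
    intro i
    have h : ∀ᶠ p : X × X in 𝓝 ((z i).1, (z (i + 1)).2),
        c p.1 p.2 < c (z i).1 (z (i + 1)).2 + ε :=
      hc.continuousAt.eventually_lt_const (lt_add_of_pos_right _ hε)
    obtain ⟨A, hA, B, hB, hAB⟩ := mem_nhds_prod_iff.1 h
    exact ⟨A, hA, B, hB, fun x hx y hy => (hAB (mk_mem_prod hx hy)).le⟩
  choose A hA B hB hAB using h1
  choose C hC D hD hCD using h2
  have hU : ∀ i, ∃ U ∈ b, (z i).1 ∈ U ∧ U ⊆ A i ∩ C i := fun i =>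
    hb.mem_nhds_iff.1 (inter_mem (hA i) (hC i))
  -- `V i` is the target of `U i` before the shift and of `U (i - 1)` after it.
  have hV : ∀ i, ∃ V ∈ b, (z i).2 ∈ V ∧ V ⊆ B i ∩ D (i - 1) := fun i =>
    hb.mem_nhds_iff.1 (inter_mem (hB i) (by simpa using hD (i - 1)))
  choose U hUb hzU hUs using hU
  choose V hVb hzV hVs using hV
  refine ⟨N, z, U, V, hzS, fun i => ⟨hUb i, hVb i, hzU i, hzV i⟩,
    fun i => c (z i).1 (z i).2 - ε, fun i => c (z i).1 (z (i + 1)).2 + ε, ?_, ?_, ?_⟩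
  · have h3 : ∑ i, c (z i).1 (z i).2 ≤ ∑ i, (c (z i).1 (z i).2 - ε) + (N + 1) * ε := by
      calc ∑ i, c (z i).1 (z i).2 ≤ ∑ i, (c (z i).1 (z i).2 - ε + ε) :=
            Finset.sum_le_sum fun i _ => le_tsub_add
        _ = _ := by simp [Finset.sum_add_distrib]
    have h4 := hgap.trans_le h3
    rw [Finset.sum_add_distrib]
    simp only [Finset.sum_const, Finset.card_univ, Fintype.card_fin, nsmul_eq_mul]
    push_cast
    refine lt_of_add_lt_add_right (a := (N + 1) * ε) ?_
    convert h4 using 1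
    ring
  · intro i x hx y hy
    exact tsub_le_iff_right.2 (hAB i x (hUs i hx).1 y (hVs i hy).1)
  · intro i x hx y hy
    exact hCD i x (hUs i hx).2 y (by simpa using (hVs (i + 1) hy).2)

variable [MeasurableSpace X] {N : ℕ}

/-- Total mass `t` on every `U i × V i`, distributed like `ν`. -/
noncomputable def exchangeRemoved (ν : Measure (X × X)) (U V : Fin (N + 1) → Set X) (t : ℝ≥0∞) :
    Measure (X × X) :=
  t • ∑ i, cond ν (U i ×ˢ V i)

/-- The measure with the marginals of `exchangeRemoved ν U V t` that couples `U i` with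
`V (i + 1)`. -/
noncomputable def exchangeAdded (ν : Measure (X × X)) (U V : Fin (N + 1) → Set X) (t : ℝ≥0∞) :
    Measure (X × X) :=
  t • ∑ i, (cond ν (U i ×ˢ V i)).fst.prod (cond ν (U (i + 1) ×ˢ V (i + 1))).snd

theorem Measure.fst_smul_sum {ι : Type*} (s : Finset ι) (t : ℝ≥0∞) (μ : ι → Measure (X × X)) :
    (t • ∑ i ∈ s, μ i).fst = t • ∑ i ∈ s, (μ i).fst := by
  ext A hA
  simp [Measure.fst_apply hA, Measure.finsetSum_apply]

theorem Measure.snd_smul_sum {ι : Type*} (s : Finset ι) (t : ℝ≥0∞) (μ : ι → Measure (X × X)) :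
    (t • ∑ i ∈ s, μ i).snd = t • ∑ i ∈ s, (μ i).snd := by
  ext A hA
  simp [Measure.snd_apply hA, Measure.finsetSum_apply]

variable {ν : Measure (X × X)} {U V : Fin (N + 1) → Set X} {t : ℝ≥0∞}

/-- Positive finite mass makes the conditioned measures probabilities, so the products have the
intended marginals. The shift only permutes the second marginals. -/
theorem fst_exchangeAdded (h0 : ∀ i, ν (U i ×ˢ V i) ≠ 0) (h1 : ∀ i, ν (U i ×ˢ V i) ≠ ⊤) :
    (exchangeAdded ν U V t).fst = (exchangeRemoved ν U V t).fst := by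
  have := fun i => cond_isProbabilityMeasure_of_finite (h0 i) (h1 i)
  simp only [exchangeAdded, exchangeRemoved, Measure.fst_smul_sum, Measure.fst_prod]

theorem snd_exchangeAdded (h0 : ∀ i, ν (U i ×ˢ V i) ≠ 0) (h1 : ∀ i, ν (U i ×ˢ V i) ≠ ⊤) :
    (exchangeAdded ν U V t).snd = (exchangeRemoved ν U V t).snd := by
  have := fun i => cond_isProbabilityMeasure_of_finite (h0 i) (h1 i)
  simp only [exchangeAdded, exchangeRemoved, Measure.snd_smul_sum, Measure.snd_prod]
  congr 1
  exact Fintype.sum_equiv (Equiv.addRight (1 : Fin (N + 1))) _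
    (fun i => (cond ν (U i ×ˢ V i)).snd) fun i => rfl

theorem transportCost_smul_sum {ι : Type*} (c : X → X → ℝ≥0) (s : Finset ι) (t : ℝ≥0∞)
    (μ : ι → Measure (X × X)) :
    transportCost c (t • ∑ i ∈ s, μ i) = t * ∑ i ∈ s, transportCost c (μ i) := by
  simp [transportCost, lintegral_smul_measure, lintegral_finsetSum_measure]

theorem le_transportCost_exchangeRemoved {c : X → X → ℝ≥0} {α : Fin (N + 1) → ℝ≥0}
    (hU : ∀ i, MeasurableSet (U i)) (hV : ∀ i, MeasurableSet (V i))
    (h0 : ∀ i, ν (U i ×ˢ V i) ≠ 0) (h1 : ∀ i, ν (U i ×ˢ V i) ≠ ⊤)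
    (hα : ∀ i, ∀ x ∈ U i, ∀ y ∈ V i, α i ≤ c x y) :
    t * ((∑ i, α i : ℝ≥0) : ℝ≥0∞) ≤ transportCost c (exchangeRemoved ν U V t) := by
  rw [exchangeRemoved, transportCost_smul_sum, ENNReal.ofNNReal_finsetSum]
  gcongr with i
  have := cond_isProbabilityMeasure_of_finite (h0 i) (h1 i)
  calc (α i : ℝ≥0∞) = ∫⁻ _, α i ∂(cond ν (U i ×ˢ V i)) := by simp
    _ ≤ _ := lintegral_mono_ae ?_
  filter_upwards [ae_cond_mem ((hU i).prod (hV i))] with p hp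
  exact_mod_cast hα i _ hp.1 _ hp.2

theorem transportCost_exchangeAdded_le {c : X → X → ℝ≥0} {β : Fin (N + 1) → ℝ≥0}
    (hU : ∀ i, MeasurableSet (U i)) (hV : ∀ i, MeasurableSet (V i))
    (h0 : ∀ i, ν (U i ×ˢ V i) ≠ 0) (h1 : ∀ i, ν (U i ×ˢ V i) ≠ ⊤)
    (hβ : ∀ i, ∀ x ∈ U i, ∀ y ∈ V (i + 1), c x y ≤ β i) :
    transportCost c (exchangeAdded ν U V t) ≤ t * ((∑ i, β i : ℝ≥0) : ℝ≥0∞) := by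
  have hp := fun i => cond_isProbabilityMeasure_of_finite (h0 i) (h1 i)
  rw [exchangeAdded, transportCost_smul_sum, ENNReal.ofNNReal_finsetSum]
  gcongr with i
  set κ := (cond ν (U i ×ˢ V i)).fst.prod (cond ν (U (i + 1) ×ˢ V (i + 1))).snd
  calc transportCost c κ ≤ ∫⁻ _, β i ∂κ := lintegral_mono_ae ?_
    _ = β i := by simp [κ]
  have e1 : ∀ᵐ p ∂κ, p.1 ∈ U i := by
    refine Measure.quasiMeasurePreserving_fst.ae ?_
    refine (ae_map_iff measurable_fst.aemeasurable (hU i)).2 ?_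
    filter_upwards [ae_cond_mem ((hU i).prod (hV i))] with p hp using hp.1
  have e2 : ∀ᵐ p ∂κ, p.2 ∈ V (i + 1) := by
    refine Measure.quasiMeasurePreserving_snd.ae ?_
    refine (ae_map_iff measurable_snd.aemeasurable (hV (i + 1))).2 ?_
    filter_upwards [ae_cond_mem ((hU (i + 1)).prod (hV (i + 1)))] with p hp using hp.2
  filter_upwards [e1, e2] with p hp1 hp2
  exact_mod_cast hβ i _ hp1 _ hp2

theorem transportCost_exchangeAdded_lt {c : X → X → ℝ≥0} (hUV : IsCyclicViolation c U V)
    (hU : ∀ i, MeasurableSet (U i)) (hV : ∀ i, MeasurableSet (V i))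
    (h0 : ∀ i, ν (U i ×ˢ V i) ≠ 0) (h1 : ∀ i, ν (U i ×ˢ V i) ≠ ⊤) (ht0 : t ≠ 0) (ht : t ≠ ⊤) :
    transportCost c (exchangeAdded ν U V t) < transportCost c (exchangeRemoved ν U V t) := by
  obtain ⟨α, β, hlt, hα, hβ⟩ := hUV
  refine (transportCost_exchangeAdded_le hU hV h0 h1 hβ).trans_lt
    (lt_of_lt_of_le ?_ (le_transportCost_exchangeRemoved hU hV h0 h1 hα))
  exact (ENNReal.mul_lt_mul_iff_right ht0 ht).2 (by exact_mod_cast hlt)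

end Exchange

/-! ### Optimal couplings have cyclically monotone support -/

section Optimal

variable {X : Type*} [TopologicalSpace X] [SecondCountableTopology X] [MeasurableSpace X]
  [BorelSpace X] {c : X → X → ℝ≥0}

/-- An optimal coupling of finite cost has cyclically monotone support. -/
theorem IsOptimalCoupling.isCyclicallyMonotone_support
    (hc : Continuous fun p : X × X => c p.1 p.2) {lam mu : Measure X} {q : Measure (X × X)}
    [IsFiniteMeasure q] (hq : IsOptimalCoupling c lam mu q) (hfin : transportCost c q ≠ ⊤) :
    IsCyclicallyMonotone c q.support := by
  by_contra hS
  obtain ⟨N, z, U, V, hz, hzUV, hviol⟩ :=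
    exists_isCyclicViolation hc (TopologicalSpace.isBasis_countableBasis X) hS
  have hUo : ∀ i, IsOpen (U i) := fun i => TopologicalSpace.isOpen_of_mem_countableBasis (hzUV i).1
  have hVo : ∀ i, IsOpen (V i) := fun i =>
    TopologicalSpace.isOpen_of_mem_countableBasis (hzUV i).2.1
  have h0 : ∀ i, q (U i ×ˢ V i) ≠ 0 := fun i =>
    ((Measure.mem_support_iff_forall _).1 (hz i) _
      (((hUo i).prod (hVo i)).mem_nhds (hzUV i).2.2)).ne'
  have h1 : ∀ i, q (U i ×ˢ V i) ≠ ⊤ := fun i => measure_ne_top _ _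
  obtain ⟨i₀, -, hi₀⟩ := Finset.exists_min_image Finset.univ (fun i => q (U i ×ˢ V i))
    Finset.univ_nonempty
  -- The smallest box mass, shared among `N + 1` summands: each conditioned measure is at most `q /
  -- q (U i₀ ×ˢ V i₀)`, so the removed measure stays below `q`.
  set t : ℝ≥0∞ := q (U i₀ ×ˢ V i₀) / (N + 1) with ht
  have ht0 : t ≠ 0 := by simp [ht, ENNReal.div_eq_zero_iff, h0]
  have ht1 : t ≠ ⊤ := (ENNReal.div_lt_top (h1 _) (by simp)).ne
  have hRle : exchangeRemoved q U V t ≤ q := by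
    refine Measure.le_iff.2 fun s hs => ?_
    simp only [exchangeRemoved, Measure.smul_apply, Measure.finsetSum_apply, smul_eq_mul]
    calc t * ∑ i, (cond q (U i ×ˢ V i)) s ≤ t * ∑ i : Fin (N + 1), q s / q (U i₀ ×ˢ V i₀) := by
          gcongr with i
          rw [cond_apply ((hUo i).prod (hVo i)).measurableSet, mul_comm, ← div_eq_mul_inv]
          exact ENNReal.div_le_div (measure_mono inter_subset_right) (hi₀ i (Finset.mem_univ i))
      _ = q s := by
          simp only [Finset.sum_const, Finset.card_univ, Fintype.card_fin, nsmul_eq_mul, ht]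
          push_cast
          have e1 : ((N : ℝ≥0∞) + 1) ≠ 0 := by simp
          have e2 : ((N : ℝ≥0∞) + 1) ≠ ⊤ := by simp
          rw [← mul_assoc, ENNReal.div_mul_cancel e1 e2, ENNReal.mul_div_cancel (h0 _) (h1 _)]
  set R := exchangeRemoved q U V t
  set A := exchangeAdded q U V t
  have : IsFiniteMeasure R := isFiniteMeasure_of_le q hRle
  have hsub : q - R + R = q := Measure.sub_add_cancel_of_le hRle
  have hlt : transportCost c A < transportCost c R :=
    transportCost_exchangeAdded_lt hviol (fun i => (hUo i).measurableSet)
      (fun i => (hVo i).measurableSet) h0 h1 ht0 ht1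
  have hcoup : IsCoupling lam mu (q - R + A) := by
    refine ⟨?_, ?_⟩
    · rw [← hq.1.1, Measure.fst_add, fst_exchangeAdded h0 h1, ← Measure.fst_add, hsub]
    · rw [← hq.1.2, Measure.snd_add, snd_exchangeAdded h0 h1, ← Measure.snd_add, hsub]
  have hle := hq.2 _ hcoup
  have hadd : ∀ μ ν : Measure (X × X),
      transportCost c (μ + ν) = transportCost c μ + transportCost c ν := fun μ ν =>
    lintegral_add_measure _ _ _
  have hq' : transportCost c q = transportCost c (q - R) + transportCost c R := by
    rw [← hadd, hsub]
  rw [hadd, hq'] at hle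
  -- The strict saving survives adding the cost of `q - R` because that cost is finite.
  refine hle.not_gt (ENNReal.add_lt_add_left ?_ hlt)
  exact ne_top_of_le_ne_top hfin (hq' ▸ le_self_add)

end Optimal

/-! ### Cyclically monotone measures are optimal -/

section Potential

variable {X : Type*}

/-- Rüschendorf's sum along the chain of points `l` that ends at `p₀`. -/
def chainCost (c : X → X → ℝ≥0) (p₀ : X × X) : List (X × X) → X → ℝ
  | [], x => c x p₀.2 - c p₀.1 p₀.2
  | p :: l, x => chainCost c p₀ l p.1 + c x p.2 - c p.1 p.2

/-- Unfolds the recursion into a sum along a sequence from `p` to `p₀`, to which cyclical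
monotonicity applies once the cycle is closed. -/
theorem exists_chainCost_eq_sum (c : X → X → ℝ≥0) {p₀ : X × X} {S : Set (X × X)} (h₀ : p₀ ∈ S)
    (l : List (X × X)) (hl : ∀ p ∈ l, p ∈ S) {p : X × X} (hp : p ∈ S) :
    ∃ (N : ℕ) (z : ℕ → X × X), (∀ i, z i ∈ S) ∧ z 0 = p ∧ z N = p₀ ∧
      chainCost c p₀ l p.1 =
        ∑ i ∈ Finset.range N, ((c (z i).1 (z (i + 1)).2 : ℝ) - c (z (i + 1)).1 (z (i + 1)).2) := by
  induction l generalizing p with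
  | nil =>
    refine ⟨1, fun i => if i = 0 then p else p₀, fun i => ?_, by simp, by simp, by simp [chainCost]⟩
    dsimp only
    split_ifs
    exacts [hp, h₀]
  | cons a l ih =>
    have ha : a ∈ S := hl a (by simp)
    obtain ⟨N, z, hz, hz0, hzN, hsum⟩ := ih (fun p hp => hl p (by simp [hp])) ha
    refine ⟨N + 1, fun i => Nat.casesOn i p z, fun i => ?_, rfl, hzN, ?_⟩
    · cases i
      exacts [hp, hz _]
    · rw [Finset.sum_range_succ']
      change chainCost c p₀ l a.1 + c p.1 a.2 - c a.1 a.2 =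
        ∑ i ∈ Finset.range N, ((c (z i).1 (z (i + 1)).2 : ℝ) - c (z (i + 1)).1 (z (i + 1)).2) +
          ((c p.1 (z 0).2 : ℝ) - c (z 0).1 (z 0).2)
      rw [hsum, hz0, add_sub_assoc]

theorem IsCyclicallyMonotone.sum_range_le {c : X → X → ℝ≥0} {S : Set (X × X)}
    (hS : IsCyclicallyMonotone c S) (N : ℕ) (z : ℕ → X × X) (hz : ∀ i, z i ∈ S) :
    ∑ i ∈ Finset.range (N + 1), c (z i).1 (z i).2 ≤
      ∑ i ∈ Finset.range N, c (z i).1 (z (i + 1)).2 + c (z N).1 (z 0).2 := by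
  have h := hS N (fun i => z i) fun i => hz i
  rw [Fin.sum_univ_castSucc (f := fun i : Fin (N + 1) => c (z i).1 (z (i + 1 : Fin (N + 1))).2)] at h
  rw [Finset.sum_range, Finset.sum_range]
  simpa [Fin.val_add_one_of_lt, Fin.castSucc_lt_last] using h

/-- Closing the chain by the step from `p₀` back to `p` gives a lower bound independent of the
chain; it keeps the potential above `-∞` on `S`. -/
theorem IsCyclicallyMonotone.le_chainCost {c : X → X → ℝ≥0} {S : Set (X × X)}
    (hS : IsCyclicallyMonotone c S) {p₀ : X × X} (h₀ : p₀ ∈ S)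
    (l : List (X × X)) (hl : ∀ p ∈ l, p ∈ S) {p : X × X} (hp : p ∈ S) :
    (c p.1 p.2 : ℝ) - c p₀.1 p.2 ≤ chainCost c p₀ l p.1 := by
  obtain ⟨N, z, hz, hz0, hzN, hsum⟩ := exists_chainCost_eq_sum c h₀ l hl hp
  have h := hS.sum_range_le N z hz
  rw [Finset.sum_range_succ', hz0, hzN] at h
  have h' : (∑ i ∈ Finset.range N, (c (z (i + 1)).1 (z (i + 1)).2 : ℝ)) + c p.1 p.2 ≤
      ∑ i ∈ Finset.range N, (c (z i).1 (z (i + 1)).2 : ℝ) + c p₀.1 p.2 := by exact_mod_cast h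
  rw [hsum, Finset.sum_sub_distrib]
  linarith

theorem continuous_chainCost [TopologicalSpace X] {c : X → X → ℝ≥0}
    (hc : Continuous fun p : X × X => c p.1 p.2) (p₀ : X × X) (l : List (X × X)) :
    Continuous (chainCost c p₀ l) := by
  have h : ∀ y, Continuous fun x => (c x y : ℝ) := fun y =>
    NNReal.continuous_coe.comp (hc.comp (continuous_id.prodMk continuous_const))
  cases l with
  | nil => exact (h _).sub continuous_const
  | cons p l => exact (continuous_const.add (h _)).sub continuous_const

/-- A cyclically monotone set carries a pair of measurable Kantorovich potentials. -/
theorem IsCyclicallyMonotone.exists_potentials [TopologicalSpace X] [MeasurableSpace X]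
    [BorelSpace X] {c : X → X → ℝ≥0} (hc : Continuous fun p : X × X => c p.1 p.2)
    {S : Set (X × X)} (hS : IsCyclicallyMonotone c S) :
    ∃ φ ψ : X → ℝ, Measurable φ ∧ Measurable ψ ∧ (∀ p ∈ S, φ p.1 + ψ p.2 = c p.1 p.2) ∧
      ∀ p ∈ S, ∀ p' ∈ S, φ p.1 + ψ p'.2 ≤ c p.1 p'.2 := by
  rcases S.eq_empty_or_nonempty with rfl | ⟨p₀, h₀⟩
  · exact ⟨0, 0, measurable_const, measurable_const, by simp, by simp⟩
  -- The infimum may be `-∞` away from `S`, hence `EReal`. Although there may be uncountably many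
  -- chains, it is upper semicontinuous and so measurable.
  let φ : X → EReal := fun x => ⨅ l : {l : List (X × X) // ∀ p ∈ l, p ∈ S}, (chainCost c p₀ l.1 x : ℝ)
  have hφm : Measurable φ := (upperSemicontinuous_iInf
    fun l : {l : List (X × X) // ∀ p ∈ l, p ∈ S} => (continuous_coe_real_ereal.comp (continuous_chainCost hc p₀ l.1)).upperSemicontinuous).measurable
  have hφS : ∀ p ∈ S, ((φ p.1).toReal : EReal) = φ p.1 := by
    intro p hp
    refine EReal.coe_toReal ?_ ?_
    · exact ((iInf_le (fun l : {l : List (X × X) // ∀ p ∈ l, p ∈ S} =>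
        ((chainCost c p₀ l.1 p.1 : ℝ) : EReal)) ⟨[], by simp⟩).trans_lt (EReal.coe_lt_top _)).ne
    · refine ((EReal.bot_lt_coe ((c p.1 p.2 : ℝ) - c p₀.1 p.2)).trans_le ?_).ne'
      exact le_iInf fun l => EReal.coe_le_coe_iff.2 (hS.le_chainCost h₀ l.1 l.2 hp)
  have hφle : ∀ p ∈ S, ∀ p' ∈ S, (φ p.1).toReal ≤ (φ p'.1).toReal + c p.1 p'.2 - c p'.1 p'.2 := by
    intro p hp p' hp'
    have : (((φ p.1).toReal - c p.1 p'.2 + c p'.1 p'.2 : ℝ) : EReal) ≤ φ p'.1 := by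
      refine le_iInf fun l => EReal.coe_le_coe_iff.2 ?_
      -- Prefixing a chain for `p'` by `p'` itself gives a chain for `p`.
      have h1 : φ p.1 ≤ (chainCost c p₀ (p' :: l.1) p.1 : ℝ) :=
        iInf_le (fun l : {l : List (X × X) // ∀ p ∈ l, p ∈ S} => ((chainCost c p₀ l.1 p.1 : ℝ) : EReal))
          ⟨p' :: l.1, by simpa using ⟨hp', by simpa using l.2⟩⟩
      rw [← hφS p hp, EReal.coe_le_coe_iff] at h1
      simp only [chainCost] at h1
      linarith
    rw [← hφS p' hp', EReal.coe_le_coe_iff] at this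
    linarith
  -- The `c`-transform of `φ` over `S`; by `hφle`, at `p.2` the infimum is attained at `p`.
  let ψ : X → EReal := fun y => ⨅ p : S, ((c p.1.1 y - (φ p.1.1).toReal : ℝ) : EReal)
  have hψm : Measurable ψ := (upperSemicontinuous_iInf fun p : S =>
    (continuous_coe_real_ereal.comp ((NNReal.continuous_coe.comp (hc.comp
      (continuous_const.prodMk continuous_id))).sub continuous_const)).upperSemicontinuous).measurable
  have hψS : ∀ p ∈ S, (ψ p.2).toReal = c p.1 p.2 - (φ p.1).toReal := by
    intro p hp
    have : ψ p.2 = ((c p.1 p.2 - (φ p.1).toReal : ℝ) : EReal) := by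
      refine le_antisymm (iInf_le (fun p' : S =>
        ((c p'.1.1 p.2 - (φ p'.1.1).toReal : ℝ) : EReal)) ⟨p, hp⟩) (le_iInf fun p' => ?_)
      refine EReal.coe_le_coe_iff.2 ?_
      linarith [hφle p'.1 p'.2 p hp]
    rw [this, EReal.toReal_coe]
  refine ⟨fun x => (φ x).toReal, fun y => (ψ y).toReal, hφm.ereal_toReal, hψm.ereal_toReal,
    fun p hp => ?_, fun p hp p' hp' => ?_⟩
  · simp only [hψS p hp]
    ring
  · simp only [hψS p' hp']
    linarith [hφle p hp p' hp']

end Potential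

/-! ### Truncation of potentials that need not be integrable -/

section Truncation

theorem clamp_add_clamp_le {n a b c : ℝ} (hn : 0 ≤ n) (hc : 0 ≤ c) (h : a + b ≤ c) :
    max (-n) (min n a) + max (-n) (min n b) ≤ c := by
  rcases max_cases (-n) (min n a) with h1 | h1 <;> rcases max_cases (-n) (min n b) with h2 | h2 <;>
    rcases min_cases n a with h3 | h3 <;> rcases min_cases n b with h4 | h4 <;> linarith

theorem clamp_add_clamp_nonneg {n a b : ℝ} (h : 0 ≤ a + b) :
    0 ≤ max (-n) (min n a) + max (-n) (min n b) := by
  rcases max_cases (-n) (min n a) with h1 | h1 <;> rcases max_cases (-n) (min n b) with h2 | h2 <;>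
    rcases min_cases n a with h3 | h3 <;> rcases min_cases n b with h4 | h4 <;> linarith

theorem tendsto_clamp (a : ℝ) :
    Tendsto (fun n : ℕ => max (-(n : ℝ)) (min n a)) atTop (𝓝 a) := by
  refine tendsto_const_nhds.congr' ?_
  obtain ⟨k, hk⟩ := exists_nat_ge |a|
  filter_upwards [eventually_ge_atTop k] with n hn
  have : |a| ≤ n := hk.trans (by exact_mod_cast hn)
  rw [min_eq_right (abs_le.1 this).2, max_eq_right (abs_le.1 this).1]

end Truncation

section Optimality

theorem measurableSet_image_of_isClosed {X Y : Type*} [TopologicalSpace X] [SigmaCompactSpace X]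
    [TopologicalSpace Y] [T2Space Y]
    [MeasurableSpace Y] [BorelSpace Y] {f : X → Y} (hf : Continuous f) {S : Set X}
    (hS : IsClosed S) : MeasurableSet (f '' S) := by
  rw [← inter_univ S, ← iUnion_compactCovering, inter_iUnion, image_iUnion]
  exact MeasurableSet.iUnion fun n =>
    (((isCompact_compactCovering X n).inter_left hS).image hf).measurableSet

variable {X : Type*} [TopologicalSpace X] [T2Space X] [SigmaCompactSpace X]
  [MeasurableSpace X] [BorelSpace X] {c : X → X → ℝ≥0}

/-- A measure that is carried by a closed cyclically monotone set has least cost among the measures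
with the same marginals. -/
theorem IsCyclicallyMonotone.transportCost_le (hc : Continuous fun p : X × X => c p.1 p.2)
    {S : Set (X × X)} (hS : IsCyclicallyMonotone c S) (hclosed : IsClosed S)
    {q q' : Measure (X × X)} [IsFiniteMeasure q] [IsFiniteMeasure q'] (hq : ∀ᵐ p ∂q, p ∈ S)
    (h1 : q'.fst = q.fst) (h2 : q'.snd = q.snd) : transportCost c q ≤ transportCost c q' := by
  obtain ⟨φ, ψ, hφ, hψ, heq, hle⟩ := hS.exists_potentials hc
  set ξ : ℕ → X × X → ℝ := fun n p => max (-(n : ℝ)) (min n (φ p.1)) + max (-(n : ℝ)) (min n (ψ p.2))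
    with hξ
  have hm1 : ∀ n : ℕ, Measurable fun x => max (-(n : ℝ)) (min n (φ x)) := fun n =>
    measurable_const.max (measurable_const.min hφ)
  have hm2 : ∀ n : ℕ, Measurable fun x => max (-(n : ℝ)) (min n (ψ x)) := fun n =>
    measurable_const.max (measurable_const.min hψ)
  have hb : ∀ (n : ℕ) (a : ℝ), ‖max (-(n : ℝ)) (min n a)‖ ≤ n := fun n a => by
    rw [Real.norm_eq_abs, abs_le]
    exact ⟨le_max_left _ _, max_le (by linarith [n.cast_nonneg (α := ℝ)]) (min_le_left _ _)⟩
  have hint : ∀ (κ : Measure (X × X)) [IsFiniteMeasure κ] (n : ℕ), Integrable (ξ n) κ ∧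
      ∫ p, ξ n p ∂κ = ∫ x, max (-(n : ℝ)) (min n (φ x)) ∂κ.fst +
        ∫ y, max (-(n : ℝ)) (min n (ψ y)) ∂κ.snd := by
    intro κ _ n
    have i1 : Integrable (fun p : X × X => max (-(n : ℝ)) (min n (φ p.1))) κ :=
      Integrable.of_bound ((hm1 n).comp measurable_fst).aestronglyMeasurable n
        (ae_of_all _ fun p => hb n _)
    have i2 : Integrable (fun p : X × X => max (-(n : ℝ)) (min n (ψ p.2))) κ :=
      Integrable.of_bound ((hm2 n).comp measurable_snd).aestronglyMeasurable n
        (ae_of_all _ fun p => hb n _)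
    refine ⟨i1.add i2, ?_⟩
    rw [hξ, integral_add i1 i2, Measure.fst, Measure.snd,
      integral_map measurable_fst.aemeasurable (hm1 n).aestronglyMeasurable,
      integral_map measurable_snd.aemeasurable (hm2 n).aestronglyMeasurable]
  -- The potentials are controlled only over the projections of `S`; `q'` lives over these because
  -- it shares its marginals with `q`.
  have hq1 : ∀ᵐ p ∂q', ∃ y, (p.1, y) ∈ S := by
    have hmeas : MeasurableSet (Prod.fst '' S) := measurableSet_image_of_isClosed continuous_fst hclosed
    have h : ∀ᵐ x ∂q'.fst, x ∈ Prod.fst '' S := by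
      rw [h1]
      refine (ae_map_iff measurable_fst.aemeasurable hmeas).2 ?_
      filter_upwards [hq] with p hp using ⟨p, hp, rfl⟩
    filter_upwards [(ae_map_iff measurable_fst.aemeasurable hmeas).1 h] with p hp
    obtain ⟨⟨x, y⟩, hxy, rfl⟩ := hp
    exact ⟨y, hxy⟩
  have hq2 : ∀ᵐ p ∂q', ∃ x, (x, p.2) ∈ S := by
    have hmeas : MeasurableSet (Prod.snd '' S) := measurableSet_image_of_isClosed continuous_snd hclosed
    have h : ∀ᵐ x ∂q'.snd, x ∈ Prod.snd '' S := by
      rw [h2]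
      refine (ae_map_iff measurable_snd.aemeasurable hmeas).2 ?_
      filter_upwards [hq] with p hp using ⟨p, hp, rfl⟩
    filter_upwards [(ae_map_iff measurable_snd.aemeasurable hmeas).1 h] with p hp
    obtain ⟨⟨x, y⟩, hxy, rfl⟩ := hp
    exact ⟨x, hxy⟩
  -- The integral of `ξ n` depends on the marginals alone, so it passes from `q` to `q'`. Fatou's
  -- lemma then removes the truncation, as `ξ n` tends to the cost on `S`.
  have hbound : ∀ n, ∫⁻ p, ENNReal.ofReal (ξ n p) ∂q ≤ transportCost c q' := by
    intro n
    have hnn : 0 ≤ᵐ[q] ξ n := by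
      filter_upwards [hq] with p hp
      exact clamp_add_clamp_nonneg (by rw [heq p hp]; positivity)
    rw [← ofReal_integral_eq_lintegral_ofReal (hint q n).1 hnn, (hint q n).2, ← h1, ← h2,
      ← (hint q' n).2]
    calc ENNReal.ofReal (∫ p, ξ n p ∂q') ≤ ENNReal.ofReal (∫ p, max (ξ n p) 0 ∂q') :=
          ENNReal.ofReal_le_ofReal (integral_mono (hint q' n).1 (hint q' n).1.pos_part
            fun p => le_max_left _ _)
      _ = ∫⁻ p, ENNReal.ofReal (max (ξ n p) 0) ∂q' :=
          ofReal_integral_eq_lintegral_ofReal (hint q' n).1.pos_part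
            (ae_of_all _ fun p => le_max_right _ _)
      _ ≤ transportCost c q' := lintegral_mono_ae ?_
    filter_upwards [hq1, hq2] with p hp1 hp2
    obtain ⟨y, hy⟩ := hp1
    obtain ⟨x, hx⟩ := hp2
    rw [← ENNReal.ofReal_coe_nnreal]
    exact ENNReal.ofReal_le_ofReal (max_le (clamp_add_clamp_le n.cast_nonneg (by positivity)
      (hle (p.1, y) hy (x, p.2) hx)) (by positivity))
  calc transportCost c q = ∫⁻ p, liminf (fun n => ENNReal.ofReal (ξ n p)) atTop ∂q := by
        refine lintegral_congr_ae ?_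
        filter_upwards [hq] with p hp
        have : Tendsto (fun n => ENNReal.ofReal (ξ n p)) atTop (𝓝 (c p.1 p.2)) := by
          rw [← ENNReal.ofReal_coe_nnreal, ← heq p hp]
          exact (ENNReal.continuous_ofReal.tendsto _).comp
            ((tendsto_clamp _).add (tendsto_clamp _))
        exact this.liminf_eq.symm
    _ ≤ liminf (fun n => ∫⁻ p, ENNReal.ofReal (ξ n p) ∂q) atTop := lintegral_liminf_le fun n =>
        (((hm1 n).comp measurable_fst).add ((hm2 n).comp measurable_snd)).ennreal_ofReal
    _ ≤ transportCost c q' := liminf_le_of_frequently_le' (Frequently.of_forall hbound)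

end Optimality

/-! ### Monge maps and local optimality -/

section Measures

variable {X : Type*} [MeasurableSpace X]

theorem transportCost_add (c : X → X → ℝ≥0) (q q' : Measure (X × X)) :
    transportCost c (q + q') = transportCost c q + transportCost c q' :=
  lintegral_add_measure _ _ _

theorem transportCost_smul (c : X → X → ℝ≥0) (t : ℝ≥0∞) (q : Measure (X × X)) :
    transportCost c (t • q) = t * transportCost c q :=
  lintegral_smul_measure _ _

theorem Measure.fst_smul (t : ℝ≥0∞) (q : Measure (X × X)) : (t • q).fst = t • q.fst :=
  Measure.map_smul _ _ _

theorem Measure.snd_smul (t : ℝ≥0∞) (q : Measure (X × X)) : (t • q).snd = t • q.snd :=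
  Measure.map_smul _ _ _

theorem isFiniteMeasure_of_fst_eq {q q' : Measure (X × X)} [IsFiniteMeasure q]
    (h : q'.fst = q.fst) : IsFiniteMeasure q' :=
  ⟨by rw [← Measure.fst_univ, h, Measure.fst_univ]; exact measure_lt_top _ _⟩

theorem eq_map_fst_of_ae_eq {q : Measure (X × X)} {T : X → X} (hT : Measurable T)
    (h : ∀ᵐ p ∂q, p.2 = T p.1) : q = q.fst.map fun x => (x, T x) := by
  rw [Measure.fst, Measure.map_map (by fun_prop) measurable_fst]
  conv_lhs => rw [← Measure.map_id (μ := q)]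
  refine Measure.map_congr ?_
  filter_upwards [h] with p hp
  exact Prod.ext rfl hp

end Measures

section Monge

variable {X : Type*} [MetricSpace X] [ProperSpace X] [MeasurableSpace X] [BorelSpace X]
  {c : X → X → ℝ≥0} {m : Measure X}

theorem IsCyclicallyMonotone.isOptimalCoupling (hc : Continuous fun p : X × X => c p.1 p.2)
    {q : Measure (X × X)} [IsFiniteMeasure q] (hq : IsCyclicallyMonotone c q.support) :
    IsOptimalCoupling c q.fst q.snd q := by
  refine ⟨⟨rfl, rfl⟩, fun q' hq' => ?_⟩
  have := isFiniteMeasure_of_fst_eq hq'.1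
  exact hq.transportCost_le hc Measure.isClosed_support Measure.support_mem_ae hq'.1 hq'.2

/-- Normalised to mass one, `q` is optimal for its marginals, hence is the unique optimal coupling,
which by hypothesis is induced by a map. -/
theorem MongeUniquelySolvable.exists_ae_eq_of_isCompact (hm : MongeUniquelySolvable m c)
    (hc : Continuous fun p : X × X => c p.1 p.2) {q : Measure (X × X)} [IsFiniteMeasure q]
    (hq : IsCyclicallyMonotone c q.support) (hac : q.fst ≪ m) {K L : Set X} (hK : IsCompact K)
    (hL : IsCompact L) (hKL : ∀ᵐ p ∂q, p ∈ K ×ˢ L) :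
    ∃ T : X → X, Measurable T ∧ ∀ᵐ p ∂q, p.2 = T p.1 := by
  rcases eq_or_ne q 0 with rfl | h0
  · exact ⟨id, measurable_id, by simp⟩
  have hu : q univ ≠ 0 := by simpa using h0
  have hu' : (q univ)⁻¹ ≠ 0 := by simp
  set r := (q univ)⁻¹ • q with hr
  have : IsProbabilityMeasure r :=
    ⟨by simp [hr, ENNReal.inv_mul_cancel hu (measure_ne_top _ _)]⟩
  have hrq : r ≪ q := Measure.smul_absolutelyContinuous
  have hqr : q ≪ r := Measure.absolutelyContinuous_smul hu'
  have hopt : IsOptimalCoupling c r.fst r.snd r :=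
    (hq.mono hrq.support_mono).isOptimalCoupling hc
  have hfst : ∀ᵐ x ∂r.fst, x ∈ K := by
    refine (ae_map_iff measurable_fst.aemeasurable hK.measurableSet).2 ?_
    filter_upwards [hrq hKL] with p hp using hp.1
  have hsnd : ∀ᵐ x ∂r.snd, x ∈ L := by
    refine (ae_map_iff measurable_snd.aemeasurable hL.measurableSet).2 ?_
    filter_upwards [hrq hKL] with p hp using hp.2
  obtain ⟨q₀, hq₀, T, hT, rfl⟩ := hm r.fst r.snd inferInstance inferInstance ⟨K, hK, hfst⟩
    ⟨L, hL, hsnd⟩ ((hrq.map measurable_fst).trans hac)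
  refine ⟨T, hT, hqr ?_⟩
  change ∀ᵐ p ∂r, p.2 = T p.1
  rw [hq₀.2 r hopt]
  exact (ae_map_iff (measurable_id.prodMk hT).aemeasurable
    (measurableSet_eq_fun measurable_snd (hT.comp measurable_fst))).2 (ae_of_all _ fun x => rfl)

/-- A measure with cyclically monotone support and absolutely continuous first marginal is carried
by the graph of a map. -/
theorem MongeUniquelySolvable.exists_ae_eq [Nonempty X] (hm : MongeUniquelySolvable m c)
    (hc : Continuous fun p : X × X => c p.1 p.2) {q : Measure (X × X)} [IsLocallyFiniteMeasure q]
    (hq : IsCyclicallyMonotone c q.support) (hac : q.fst ≪ m) :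
    ∃ T : X → X, Measurable T ∧ ∀ᵐ p ∂q, p.2 = T p.1 := by
  obtain ⟨x₀⟩ := ‹Nonempty X›
  let K : ℕ → Set X := fun j => Metric.closedBall x₀ j
  have hK : ∀ j, IsCompact (K j) := fun j => isCompact_closedBall _ _
  have hKm : ∀ j, MeasurableSet (K j ×ˢ K j) := fun j =>
    (hK j).measurableSet.prod (hK j).measurableSet
  have key : ∀ j, ∃ T : X → X, Measurable T ∧ ∀ᵐ p ∂q.restrict (K j ×ˢ K j), p.2 = T p.1 := by
    intro j
    have : IsFiniteMeasure (q.restrict (K j ×ˢ K j)) :=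
      ⟨by simpa using ((hK j).prod (hK j)).measure_lt_top⟩
    exact hm.exists_ae_eq_of_isCompact hc
      (hq.mono (Measure.support_mono Measure.restrict_le_self))
      (((Measure.fst_mono Measure.restrict_le_self).absolutelyContinuous).trans hac) (hK j) (hK j)
      (ae_restrict_mem (hKm j))
  choose T hT hTq using key
  -- The maps on the compact squares need not extend one another, but at almost every point the
  -- sequence is eventually constant; its limit replaces gluing.
  have hlim : ∀ᵐ p ∂q, Tendsto (fun k => T k p.1) atTop (𝓝 p.2) := by
    have h := ae_all_iff.2 fun j => (ae_restrict_iff' (hKm j)).1 (hTq j)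
    filter_upwards [h] with p hp
    obtain ⟨k, hk⟩ := exists_nat_ge (max (dist p.1 x₀) (dist p.2 x₀))
    refine tendsto_const_nhds.congr' ?_
    filter_upwards [eventually_ge_atTop k] with j hj
    have hkj : (k : ℝ) ≤ j := by exact_mod_cast hj
    exact hp j ⟨((le_max_left _ _).trans hk).trans hkj, ((le_max_right _ _).trans hk).trans hkj⟩
  have hex : ∀ᵐ x ∂q.fst, ∃ l, Tendsto (fun k => T k x) atTop (𝓝 l) := by
    refine (ae_map_iff measurable_fst.aemeasurable (measurableSet_exists_tendsto hT)).2 ?_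
    filter_upwards [hlim] with p hp using ⟨_, hp⟩
  obtain ⟨T', hT', hTT'⟩ :=
    measurable_limit_of_tendsto_metrizable_ae (fun k => (hT k).aemeasurable) hex
  refine ⟨T', hT', ?_⟩
  filter_upwards [hlim, ae_of_ae_map measurable_fst.aemeasurable hTT'] with p h1 h2
  exact tendsto_nhds_unique h1 h2

/-- A coupling of finite cost with cyclically monotone support is the unique optimal one. -/
theorem MongeUniquelySolvable.isUniqueOptimalCoupling [Nonempty X] (hm : MongeUniquelySolvable m c)
    (hc : Continuous fun p : X × X => c p.1 p.2) {q : Measure (X × X)} [IsFiniteMeasure q]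
    (hq : IsCyclicallyMonotone c q.support) (hac : q.fst ≪ m) (hfin : transportCost c q ≠ ⊤) :
    IsUniqueOptimalCoupling c q.fst q.snd q := by
  have hopt := hq.isOptimalCoupling hc
  refine ⟨hopt, fun q' hq' => ?_⟩
  have := isFiniteMeasure_of_fst_eq hq'.1.1
  have hcost : transportCost c q' = transportCost c q :=
    le_antisymm (hq'.2 _ hopt.1) (hopt.2 _ hq'.1)
  -- Half of any competitor of `q + q'` is a competitor of `q`.
  have hsum : IsOptimalCoupling c (q + q').fst (q + q').snd (q + q') := by
    refine ⟨⟨rfl, rfl⟩, fun r hr => ?_⟩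
    have h2 : ∀ {Y : Type _} [MeasurableSpace Y] (κ : Measure Y),
        (2 : ℝ≥0∞)⁻¹ • (κ + κ) = κ := by
      intro Y _ κ
      rw [← two_smul ℝ≥0∞ κ, smul_smul, ENNReal.inv_mul_cancel (by simp) (by simp), one_smul]
    have hr2 : IsCoupling q.fst q.snd ((2 : ℝ≥0∞)⁻¹ • r) := by
      refine ⟨?_, ?_⟩
      · rw [Measure.fst_smul, hr.1, Measure.fst_add, hq'.1.1, h2]
      · rw [Measure.snd_smul, hr.2, Measure.snd_add, hq'.1.2, h2]
    have h3 := hopt.2 _ hr2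
    rw [transportCost_smul] at h3
    rw [transportCost_add, hcost, ← two_mul]
    calc 2 * transportCost c q ≤ 2 * (2⁻¹ * transportCost c r) := by gcongr
      _ = transportCost c r := by
        rw [← mul_assoc, ENNReal.mul_inv_cancel (by simp) (by simp), one_mul]
  have hmono := hsum.isCyclicallyMonotone_support hc
    (by rw [transportCost_add, hcost]; exact ENNReal.add_ne_top.2 ⟨hfin, hfin⟩)
  have hac' : (q + q').fst ≪ m := by
    rw [Measure.fst_add, hq'.1.1]
    exact hac.add_left hac
  -- One map carries both summands, and they have the same first marginal.
  obtain ⟨T, hT, hgraph⟩ := hm.exists_ae_eq hc hmono hac'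
  rw [ae_add_measure_iff] at hgraph
  rw [eq_map_fst_of_ae_eq hT hgraph.1, eq_map_fst_of_ae_eq hT hgraph.2, hq'.1.1]

theorem isLocallyOptimalAt_of_isCyclicallyMonotone [Nonempty X] (hm : MongeUniquelySolvable m c)
    (hc : Continuous fun p : X × X => c p.1 p.2) {lam mu : Measure X} {q : Measure (X × X)}
    [IsLocallyFiniteMeasure lam] [IsLocallyFiniteMeasure mu] [IsLocallyFiniteMeasure q]
    (hsemi : IsSemicoupling lam mu q) (hac : lam ≪ m) (hq : IsCyclicallyMonotone c q.support)
    (hfin : ∀ A : Set X, IsCompact A → transportCost c (q.restrict (univ ×ˢ A)) ≠ ⊤) :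
    IsLocallyOptimalAt c lam mu q := by
  have hqac : q.fst ≪ m := hsemi.1.absolutelyContinuous.trans hac
  refine ⟨fun A hA hAm => ?_, hq, ?_⟩
  · have hsnd : (q.restrict (univ ×ˢ A)).snd = mu.restrict A := by
      rw [← hsemi.2, univ_prod, Measure.snd, Measure.snd, Measure.restrict_map measurable_snd hAm]
    have hAc : IsCompact (closure A) := hA.isCompact_closure
    have : IsFiniteMeasure (q.restrict (univ ×ˢ A)) := by
      refine ⟨?_⟩
      rw [← Measure.snd_univ, hsnd, Measure.restrict_apply_univ]
      exact (measure_mono subset_closure).trans_lt hAc.measure_lt_top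
    rw [← hsnd]
    refine hm.isUniqueOptimalCoupling hc
      (hq.mono (Measure.support_mono Measure.restrict_le_self))
      ((Measure.fst_mono Measure.restrict_le_self).absolutelyContinuous.trans hqac)
      (ne_top_of_le_ne_top (hfin _ hAc) ?_)
    exact lintegral_mono' (Measure.restrict_mono (prod_mono_right subset_closure) le_rfl) le_rfl
  · obtain ⟨T, hT, hgraph⟩ := hm.exists_ae_eq hc hq hqac
    have hqT := eq_map_fst_of_ae_eq hT hgraph
    have : SigmaFinite q.fst := Measure.sigmaFinite_of_le _ hsemi.1
    -- A density is determined only almost everywhere. Cutting it off outside `S` places the whole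
    -- graph over `0 < ρ`, and its closure, in the support.
    set S : Set X := {x | (x, T x) ∈ q.support} with hS
    have hSm : MeasurableSet S :=
      (measurable_id.prodMk hT) Measure.isClosed_support.measurableSet
    have hSae : ∀ᵐ x ∂q.fst, x ∈ S := by
      refine (ae_map_iff measurable_fst.aemeasurable hSm).2 ?_
      filter_upwards [hgraph, Measure.support_mem_ae (μ := q)] with p hp hps
      rwa [← hp]
    refine ⟨S.indicator fun x => (q.fst.rnDeriv lam x).toNNReal, T,
      (Measure.measurable_rnDeriv _ _).ennreal_toNNReal.indicator hSm, hT, ?_, ?_⟩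
    · refine hq.mono (closure_minimal ?_ Measure.isClosed_support)
      rintro ⟨x, y⟩ ⟨hx, hy⟩
      obtain rfl : y = T x := hy
      by_contra hxS
      exact hx.ne' (indicator_of_notMem (s := S) hxS _)
    · have hdens : lam.withDensity (fun x =>
          ((S.indicator (fun x => (q.fst.rnDeriv lam x).toNNReal) x : ℝ≥0) : ℝ≥0∞)) = q.fst := by
        have h1 : lam.withDensity (q.fst.rnDeriv lam) = q.fst :=
          Measure.withDensity_rnDeriv_eq _ _ hsemi.1.absolutelyContinuous
        calc _ = lam.withDensity (S.indicator (q.fst.rnDeriv lam)) := by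
              refine withDensity_congr_ae ?_
              filter_upwards [q.fst.rnDeriv_lt_top lam] with x hx
              by_cases hxS : x ∈ S
              · simp [hxS, ENNReal.coe_toNNReal hx.ne]
              · simp [hxS]
          _ = q.fst := by
              rw [withDensity_indicator hSm, ← restrict_withDensity hSm, h1]
              exact Measure.restrict_eq_self_of_ae_mem hSae
      rw [hdens]
      exact hqT

end Monge

/-! ### Equivariant random measures -/

theorem map_withDensity_comp {X Y : Type*} [MeasurableSpace X] [MeasurableSpace Y] (μ : Measure X)
    {f : X → Y} (hf : Measurable f) {s : Y → ℝ≥0∞} (hs : Measurable s) :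
    (μ.map f).withDensity s = (μ.withDensity fun x => s (f x)).map f := by
  ext A hA
  rw [withDensity_apply _ hA, Measure.map_apply hf hA, withDensity_apply _ (hf hA),
    setLIntegral_map hA hs hf]

theorem isSFiniteKernel_of_isRandomMeasure {Ω X : Type*} [MeasurableSpace Ω] [TopologicalSpace X]
    [T2Space X] [SigmaCompactSpace X] [MeasurableSpace X] [BorelSpace X]
    {κ : Kernel Ω X} (hκ : IsRandomMeasure κ) : IsSFiniteKernel κ := by
  have hfin : ∀ w n, κ w (compactCovering X n) < ⊤ := fun w n => by
    have := hκ w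
    exact (isCompact_compactCovering X n).measure_lt_top
  have hKm : ∀ n, MeasurableSet (compactCovering X n) := fun n =>
    (isCompact_compactCovering X n).measurableSet
  let D : ℕ → Set X := disjointed (compactCovering X)
  have hDm : ∀ n, MeasurableSet (D n) := fun n => MeasurableSet.disjointed hKm n
  have hDfin : ∀ w n, κ w (D n) < ⊤ := fun w n =>
    (measure_mono (disjointed_subset _ n)).trans_lt (hfin w n)
  -- The mass of `D n` is finite for each `w` but not uniformly so; on each level set of its integer
  -- part it is bounded.
  let E : ℕ → ℕ → Set Ω := fun n k => {w | ⌊(κ w (D n)).toNNReal⌋₊ = k}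
  have hEm : ∀ n k, MeasurableSet (E n k) := fun n k =>
    (Nat.measurable_floor.comp (κ.measurable_coe (hDm n)).ennreal_toNNReal)
      (measurableSet_singleton k)
  classical
  let κ' : ℕ → ℕ → Kernel Ω X := fun n k =>
    Kernel.piecewise (hEm n k) (κ.restrict (hDm n)) 0
  have hκ' : ∀ n k, IsFiniteKernel (κ' n k) := fun n k => by
    refine ⟨(k : ℝ≥0∞) + 1, ENNReal.add_lt_top.2 ⟨ENNReal.natCast_lt_top k, ENNReal.one_lt_top⟩,
      fun w => ?_⟩
    by_cases hw : w ∈ E n k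
    · simp only [κ', Kernel.piecewise_apply, hw, if_true, Kernel.restrict_apply,
        Measure.restrict_apply_univ]
      have h := (Nat.lt_floor_add_one (κ w (D n)).toNNReal).le
      rw [show ⌊(κ w (D n)).toNNReal⌋₊ = k from hw] at h
      rw [← ENNReal.coe_toNNReal (hDfin w n).ne]
      exact_mod_cast h
    · simp [κ', Kernel.piecewise_apply, hw]
  have hsum : κ = Kernel.sum fun n => Kernel.sum fun k => κ' n k := by
    ext w : 1
    simp only [Kernel.sum_apply]
    have h1 : ∀ n, (Measure.sum fun k => κ' n k w) = (κ w).restrict (D n) := by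
      intro n
      ext A hA
      rw [Measure.sum_apply _ hA, tsum_eq_single ⌊(κ w (D n)).toNNReal⌋₊]
      · have : w ∈ E n ⌊(κ w (D n)).toNNReal⌋₊ := rfl
        simp [κ', Kernel.piecewise_apply, this, Kernel.restrict_apply]
      · intro k hk
        have : w ∉ E n k := fun h => hk h.symm
        simp [κ', Kernel.piecewise_apply, this]
    simp only [h1]
    rw [← Measure.restrict_iUnion (disjoint_disjointed _) hDm, iUnion_disjointed,
      iUnion_compactCovering, Measure.restrict_univ]
  rw [hsum]
  infer_instance

/-! ### Superposition of translates and the Campbell formula -/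

section Translates

variable {G Ω Y : Type*} [Group G] [MeasurableSpace Ω] [MulAction G Ω]
  [MeasurableSpace Y] [MulAction G Y] [MeasurableConstSMul G Y]

theorem IsEquivariant.withDensity {κ : Kernel Ω Y} [IsSFiniteKernel κ] (hκ : IsEquivariant G κ)
    {s : Ω → Y → ℝ≥0∞} (hs : Measurable (Function.uncurry s))
    (hinv : ∀ (g : G) w y, s (g • w) (g • y) = s w y) :
    IsEquivariant G (κ.withDensity s) := by
  intro g w
  rw [Kernel.withDensity_apply _ hs, Kernel.withDensity_apply _ hs, hκ g w,
    map_withDensity_comp _ (measurable_const_smul g) hs.of_uncurry_left]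
  simp only [hinv]

theorem IsEquivariant.add {κ η : Kernel Ω Y} (hκ : IsEquivariant G κ) (hη : IsEquivariant G η) :
    IsEquivariant G (κ + η) := by
  intro g w
  rw [add_apply, add_apply, hκ g w, hη g w,
    Measure.map_add _ _ (measurable_const_smul g)]

variable [Countable G] [MeasurableConstSMul G Ω]

variable (G) in
/-- The equivariant superposition of the translates of a random measure. -/
noncomputable def translateSum (κ : Kernel Ω Y) : Kernel Ω Y :=
  Kernel.sum fun g : G =>
    (κ.comap (fun w => g⁻¹ • w) (measurable_const_smul g⁻¹)).map fun y => g • y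

theorem translateSum_apply (κ : Kernel Ω Y) (w : Ω) :
    translateSum G κ w = Measure.sum fun g : G => (κ (g⁻¹ • w)).map fun y => g • y := by
  rw [translateSum, Kernel.sum_apply]
  congr 1
  ext1 g
  rw [Kernel.map_apply _ (measurable_const_smul g), Kernel.comap_apply]

theorem isEquivariant_translateSum (κ : Kernel Ω Y) : IsEquivariant G (translateSum G κ) := by
  intro h w
  ext A hA
  rw [Measure.map_apply (measurable_const_smul h) hA, translateSum_apply, translateSum_apply,
    Measure.sum_apply _ hA, Measure.sum_apply _ (measurable_const_smul h hA),
    ← (Equiv.mulLeft h).tsum_eq]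
  refine tsum_congr fun g => ?_
  rw [Measure.map_apply (measurable_const_smul _) hA,
    Measure.map_apply (measurable_const_smul _) (measurable_const_smul h hA)]
  simp only [Equiv.coe_mulLeft, mul_inv_rev, smul_smul, inv_mul_cancel_right]
  congr 1
  ext y
  simp [mul_smul]

/-- By equivariance every translate has a density with respect to the same measure `κ w`, so
superposing translates amounts to adding densities. -/
theorem translateSum_withDensity {κ : Kernel Ω Y} [IsSFiniteKernel κ] (hκ : IsEquivariant G κ)
    {s : Ω → Y → ℝ≥0∞} (hs : Measurable (Function.uncurry s)) (w : Ω) :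
    translateSum G (κ.withDensity s) w =
      (κ w).withDensity fun y => ∑' g : G, s (g⁻¹ • w) (g⁻¹ • y) := by
  have hs' : ∀ g : G, Measurable fun y => s (g⁻¹ • w) (g⁻¹ • y) := fun g =>
    hs.of_uncurry_left.comp (measurable_const_smul g⁻¹)
  have : (fun y => ∑' g : G, s (g⁻¹ • w) (g⁻¹ • y)) = ∑' g : G, fun y => s (g⁻¹ • w) (g⁻¹ • y) := by
    ext y
    rw [tsum_apply (Pi.summable.2 fun _ => ENNReal.summable)]
  rw [translateSum_apply, this, withDensity_tsum hs']
  congr 1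
  ext1 g
  rw [Kernel.withDensity_apply _ hs]
  have h := map_withDensity_comp (κ (g⁻¹ • w)) (measurable_const_smul g) (hs' g)
  simp only [inv_smul_smul] at h
  rw [← h, ← hκ g, smul_inv_smul]

/-- A random measure with a density whose translates sum up to at most one can be split off from an
equivariant random measure equivariantly. -/
theorem exists_add_translateSum_eq {κ : Kernel Ω Y} [IsSFiniteKernel κ] (hκ : IsEquivariant G κ)
    {s : Ω → Y → ℝ≥0∞} (hs : Measurable (Function.uncurry s))
    (hle : ∀ w y, ∑' g : G, s (g⁻¹ • w) (g⁻¹ • y) ≤ 1) :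
    ∃ η : Kernel Ω Y, IsEquivariant G η ∧ η + translateSum G (κ.withDensity s) = κ := by
  have hs' : ∀ g : G, Measurable fun z : Ω × Y => s (g⁻¹ • z.1) (g⁻¹ • z.2) := fun g =>
    hs.comp (f := fun z : Ω × Y => (g⁻¹ • z.1, g⁻¹ • z.2))
      (((measurable_const_smul g⁻¹).comp measurable_fst).prodMk
        ((measurable_const_smul g⁻¹).comp measurable_snd))
  set r : Ω → Y → ℝ≥0∞ := fun w y => ∑' g : G, s (g⁻¹ • w) (g⁻¹ • y) with hr
  have hrm : Measurable (Function.uncurry r) := Measurable.tsum hs'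
  have hrinv : ∀ (g : G) w y, r (g • w) (g • y) = r w y := by
    intro g w y
    simp only [hr]
    rw [← (Equiv.mulLeft g).tsum_eq]
    simp [smul_smul]
  have hm : Measurable (Function.uncurry fun w y => 1 - r w y) := measurable_const.sub hrm
  -- Subtracting densities rather than measures makes the remainder a kernel, equivariant because
  -- `r` is invariant.
  refine ⟨κ.withDensity fun w y => 1 - r w y, hκ.withDensity hm fun g w y => by rw [hrinv], ?_⟩
  ext w : 1
  rw [add_apply, Kernel.withDensity_apply _ hm, translateSum_withDensity hκ hs,
    ← withDensity_add_left hm.of_uncurry_left]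
  have : ((fun y => 1 - r w y) + fun y => ∑' g : G, s (g⁻¹ • w) (g⁻¹ • y)) = 1 := by
    ext y
    exact tsub_add_cancel_of_le (hle w y)
  rw [this, withDensity_one]

/-- The Campbell formula: the mass that the superposition of all translates puts on a fundamental
region is the total mass. -/
theorem lintegral_translateSum (P : Measure Ω) [SMulInvariantMeasure G Ω P] (κ : Kernel Ω Y)
    [IsSFiniteKernel κ] {f : Y → ℝ≥0∞} (hf : Measurable f) (hinv : ∀ (g : G) y, f (g • y) = f y)
    {F : Set Y} (hFm : MeasurableSet F)
    (hF : ∀ y, ∑' g : G, F.indicator (fun _ => (1 : ℝ≥0∞)) (g • y) = 1) :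
    ∫⁻ w, ∫⁻ y in F, f y ∂(translateSum G κ w) ∂P = ∫⁻ w, ∫⁻ y, f y ∂(κ w) ∂P := by
  have hm : ∀ g : G, Measurable fun y : Y => F.indicator f (g • y) := fun g =>
    (hf.indicator hFm).comp (measurable_const_smul g)
  calc ∫⁻ w, ∫⁻ y in F, f y ∂(translateSum G κ w) ∂P
      = ∫⁻ w, ∑' g : G, ∫⁻ y, F.indicator f (g • y) ∂(κ (g⁻¹ • w)) ∂P := by
        refine lintegral_congr fun w => ?_
        rw [← lintegral_indicator hFm, translateSum_apply, lintegral_sum_measure]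
        exact tsum_congr fun g => lintegral_map (hf.indicator hFm) (measurable_const_smul g)
    _ = ∑' g : G, ∫⁻ w, ∫⁻ y, F.indicator f (g • y) ∂(κ (g⁻¹ • w)) ∂P :=
        lintegral_tsum fun g => (((hm g).lintegral_kernel (κ := κ)).comp
          (measurable_const_smul g⁻¹)).aemeasurable
    _ = ∑' g : G, ∫⁻ w, ∫⁻ y, F.indicator f (g • y) ∂(κ w) ∂P := by
        refine tsum_congr fun g => ?_
        exact (measurePreserving_smul g⁻¹ P).lintegral_comp
          ((hm g).lintegral_kernel (κ := κ))
    _ = ∫⁻ w, ∫⁻ y, ∑' g : G, F.indicator f (g • y) ∂(κ w) ∂P := by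
        rw [← lintegral_tsum fun g => ((hm g).lintegral_kernel (κ := κ)).aemeasurable]
        exact lintegral_congr fun w => (lintegral_tsum fun g => (hm g).aemeasurable).symm
    _ = _ := by
        refine lintegral_congr fun w => lintegral_congr fun y => ?_
        have : ∀ g : G, F.indicator f (g • y) =
            F.indicator (fun _ => (1 : ℝ≥0∞)) (g • y) * f y := by
          intro g
          by_cases h : g • y ∈ F <;> simp [h, hinv]
        simp only [this, ENNReal.tsum_mul_right, hF, one_mul]

end Translates

/-! ### Fundamental regions -/

section FundamentalRegion

variable {G M : Type*} [Group G] [MulAction G M] [MeasurableSpace M]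

theorem IsFundamentalRegion.tsum_indicator {F : Set M} (hF : IsFundamentalRegion G F) (x : M) :
    ∑' g : G, F.indicator (fun _ => (1 : ℝ≥0∞)) (g • x) = 1 := by
  obtain ⟨g, y, hy, hgy⟩ := mem_iUnion.1 (hF.iUnion_eq.symm ▸ mem_univ x : x ∈ ⋃ g : G, g • F)
  simp only at hgy
  rw [tsum_eq_single g⁻¹]
  · simp [← hgy, hy]
  · intro h hh
    refine indicator_of_notMem (fun hx => ?_) _
    refine disjoint_left.1 (hF.disjoint (h * g) fun h1 => hh (eq_inv_of_mul_eq_one_left h1)) hx ?_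
    exact ⟨y, hy, by simp [← hgy, mul_smul]⟩

theorem IsFundamentalRegion.smul [MeasurableConstSMul G M] {F : Set M}
    (hF : IsFundamentalRegion G F) (g : G) : IsFundamentalRegion G (g • F) := by
  refine ⟨hF.measurableSet.const_smul g, ?_, fun h hh => ?_⟩
  · rw [← hF.iUnion_eq, ← (Equiv.mulRight g).surjective.iUnion_comp fun h : G => h • F]
    simp [mul_smul]
  · have h1 := hF.disjoint (g⁻¹ * h * g) fun h1 => hh (by
      have : h = g * (g⁻¹ * h * g) * g⁻¹ := by group
      rw [this, h1]; group)
    have h2 := (Set.disjoint_smul_set (a := g)).2 h1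
    rwa [smul_smul, show g * (g⁻¹ * h * g) = h * g by group, mul_smul] at h2

theorem IsFundamentalRegion.pairwise_disjoint {F : Set M} (hF : IsFundamentalRegion G F) :
    Pairwise (Function.onFun Disjoint fun g : G => g • F) := by
  intro g h hgh
  have h1 := hF.disjoint (g⁻¹ * h) fun h1 => hgh (inv_mul_eq_one.1 h1)
  have h2 := (Set.disjoint_smul_set (a := g)).2 h1
  rwa [smul_smul, mul_inv_cancel_left] at h2

theorem IsFundamentalRegion.isFundamentalDomain {F : Set M} (hF : IsFundamentalRegion G F)
    (m : Measure M) : IsFundamentalDomain G F m := by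
  refine ⟨hF.measurableSet.nullMeasurableSet, ae_of_all _ fun x => ?_, fun g h hgh =>
    (hF.pairwise_disjoint hgh).aedisjoint⟩
  obtain ⟨g, y, hy, hgy⟩ := mem_iUnion.1 (hF.iUnion_eq.symm ▸ mem_univ x : x ∈ ⋃ g : G, g • F)
  exact ⟨g⁻¹, by simpa [← hgy] using hy⟩

/-- The pieces `g • K ∩ F` cover `F`, and their measures add up to that of `K`. -/
theorem IsFundamentalRegion.measure_lt_top [Countable G] [TopologicalSpace M]
    [MeasurableConstSMul G M] {m : Measure M} [SMulInvariantMeasure G M m]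
    [IsFiniteMeasureOnCompacts m] {F : Set M} (hF : IsFundamentalRegion G F) {K : Set M}
    (hK : IsCompact K) (hcov : ⋃ g : G, g • K = univ) : m F < ⊤ := by
  refine lt_of_le_of_lt ?_ (hK.measure_lt_top (μ := m))
  rw [(hF.isFundamentalDomain m).measure_eq_tsum K]
  calc m F = m (⋃ g : G, g • K ∩ F) := by rw [← iUnion_inter, hcov, univ_inter]
    _ ≤ _ := measure_iUnion_le _

end FundamentalRegion

/-! ### The mean transportation cost -/

section MeanCost

variable {G Ω M : Type*} [MeasurableSpace Ω] [MeasurableSpace M] {P : Measure Ω}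
  {c : M → M → ℝ≥0} {q : Kernel Ω (M × M)}

/-- The expected cost of the transport into `B`. -/
noncomputable def expectedCost (P : Measure Ω) (c : M → M → ℝ≥0) (q : Kernel Ω (M × M))
    (B : Set M) : ℝ≥0∞ :=
  ∫⁻ w, transportCost c ((q w).restrict (univ ×ˢ B)) ∂P

theorem measurable_transportCost_restrict (hc : Measurable fun p : M × M => c p.1 p.2)
    {S : Set (M × M)} (hS : MeasurableSet S) :
    Measurable fun w => transportCost c ((q w).restrict S) := by
  simp only [← Kernel.restrict_apply q hS]
  exact (Measure.measurable_lintegral hc.coe_nnreal_ennreal).comp (q.restrict hS).measurable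

theorem measurable_uncurry_indicator {B : Set M} (hB : MeasurableSet B) :
    Measurable (Function.uncurry fun (_ : Ω) (p : M × M) =>
      (univ ×ˢ B : Set (M × M)).indicator (fun _ => (1 : ℝ≥0∞)) p) :=
  (measurable_const.indicator (MeasurableSet.univ.prod hB)).comp measurable_snd

theorem withDensity_indicator_apply [IsSFiniteKernel q] {B : Set M} (hB : MeasurableSet B) (w : Ω) :
    q.withDensity (fun _ p => (univ ×ˢ B : Set (M × M)).indicator (fun _ => (1 : ℝ≥0∞)) p) w =
      (q w).restrict (univ ×ˢ B) := by
  rw [Kernel.withDensity_apply _ (measurable_uncurry_indicator hB)]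
  exact withDensity_indicator_one (MeasurableSet.univ.prod hB)

theorem expectedCost_add (hc : Measurable fun p : M × M => c p.1 p.2) (q q' : Kernel Ω (M × M))
    {B : Set M} (hB : MeasurableSet B) :
    expectedCost P c (q + q') B = expectedCost P c q B + expectedCost P c q' B := by
  simp only [expectedCost, add_apply, Measure.restrict_add, transportCost_add]
  exact lintegral_add_left
    (measurable_transportCost_restrict hc (MeasurableSet.univ.prod hB)) _

variable [Group G] [MulAction G M]

theorem IsFundamentalRegion.tsum_indicator_prod {F : Set M} (hF : IsFundamentalRegion G F)
    (p : M × M) :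
    ∑' g : G, (univ ×ˢ F : Set (M × M)).indicator (fun _ => (1 : ℝ≥0∞)) (g • p) = 1 := by
  refine (tsum_congr fun g => ?_).trans (hF.tsum_indicator p.2)
  by_cases h : g • p.2 ∈ F <;> simp [h, indicator]

variable [Countable G] [MulAction G Ω] [MeasurableConstSMul G Ω] [MeasurableConstSMul G (M × M)]
  [SMulInvariantMeasure G Ω P]

theorem expectedCost_translateSum (hc : Measurable fun p : M × M => c p.1 p.2)
    (hinv : ∀ (g : G) x y, c (g • x) (g • y) = c x y) [IsSFiniteKernel q] {F : Set M}
    (hF : IsFundamentalRegion G F) :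
    expectedCost P c (translateSum G q) F = ∫⁻ w, transportCost c (q w) ∂P :=
  lintegral_translateSum P q hc.coe_nnreal_ennreal (fun g p => by simp [hinv])
    (MeasurableSet.univ.prod hF.measurableSet) hF.tsum_indicator_prod

/-- Every set that meets all orbits in at most `N` points has expected cost at most `N` times that
of a fundamental region. -/
theorem expectedCost_le_of_tsum_indicator_le (hc : Measurable fun p : M × M => c p.1 p.2)
    (hinv : ∀ (g : G) x y, c (g • x) (g • y) = c x y) [IsSFiniteKernel q]
    (hq : IsEquivariant G q) {F B : Set M} (hF : IsFundamentalRegion G F) (hB : MeasurableSet B)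
    {N : ℝ≥0∞} (hN : ∀ x, ∑' g : G, B.indicator (fun _ => (1 : ℝ≥0∞)) (g • x) ≤ N) :
    expectedCost P c q B ≤ N * expectedCost P c q F := by
  set s : Ω → M × M → ℝ≥0∞ := fun _ p => (univ ×ˢ B : Set (M × M)).indicator (fun _ => 1) p
  have hs : Measurable (Function.uncurry s) := measurable_uncurry_indicator hB
  have : IsSFiniteKernel (q.withDensity s) := by
    refine Kernel.IsSFiniteKernel.withDensity q fun w p => ?_
    exact ((indicator_le (fun _ _ => le_rfl) p).trans_lt ENNReal.one_lt_top).ne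
  have h1 : expectedCost P c q B = expectedCost P c (translateSum G (q.withDensity s)) F := by
    rw [expectedCost_translateSum hc hinv hF, expectedCost]
    simp only [s, withDensity_indicator_apply hB]
  rw [h1, expectedCost, expectedCost, ← lintegral_const_mul]
  · refine lintegral_mono fun w => ?_
    have hle : translateSum G (q.withDensity s) w ≤ N • q w := by
      rw [translateSum_withDensity hq hs, ← withDensity_const]
      refine withDensity_mono (ae_of_all _ fun p => ?_)
      refine le_trans ((Equiv.inv G).tsum_eq fun g : G => s (g • w) (g • p)).le
        (le_trans (ENNReal.tsum_le_tsum fun g => ?_) (hN p.2))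
      by_cases h : g • p.2 ∈ B <;> simp [s, h, indicator]
    rw [← transportCost_smul, ← Measure.restrict_smul]
    exact lintegral_mono' (Measure.restrict_mono subset_rfl hle) le_rfl
  · exact measurable_transportCost_restrict hc (MeasurableSet.univ.prod hF.measurableSet)

theorem IsFundamentalRegion.expectedCost_eq (hc : Measurable fun p : M × M => c p.1 p.2)
    (hinv : ∀ (g : G) x y, c (g • x) (g • y) = c x y) [IsSFiniteKernel q]
    (hq : IsEquivariant G q) {F F' : Set M} (hF : IsFundamentalRegion G F)
    (hF' : IsFundamentalRegion G F') : expectedCost P c q F = expectedCost P c q F' := by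
  refine le_antisymm ?_ ?_
  · simpa using expectedCost_le_of_tsum_indicator_le (P := P) hc hinv hq hF' hF.measurableSet
      fun x => (hF.tsum_indicator x).le
  · simpa using expectedCost_le_of_tsum_indicator_le (P := P) hc hinv hq hF hF'.measurableSet
      fun x => (hF'.tsum_indicator x).le

/-- The supremum is over a constant: volume and expected cost of an admissible set are both
proportional to its number of translates, and neither depends on the fundamental region. -/
theorem meanTransportCost_eq [MeasurableConstSMul G M]
    (hc : Measurable fun p : M × M => c p.1 p.2)
    (hinv : ∀ (g : G) x y, c (g • x) (g • y) = c x y) [IsSFiniteKernel q]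
    (hq : IsEquivariant G q) {m : Measure M} [SMulInvariantMeasure G M m] {F : Set M}
    (hF : IsFundamentalRegion G F) :
    meanTransportCost G P m c q = (m F)⁻¹ * expectedCost P c q F := by
  have key : ∀ B, IsAdmissible G B →
      (m B)⁻¹ * ∫⁻ w, transportCost c ((q w).restrict (univ ×ˢ B)) ∂P =
        (m F)⁻¹ * expectedCost P c q F := by
    rintro B ⟨I, F', hI, hF', rfl⟩
    have hdisj : (I : Set G).PairwiseDisjoint fun g => g • F' := fun g _ h _ hgh =>
      hF'.pairwise_disjoint hgh
    have hmeas : ∀ g : G, MeasurableSet (g • F') := fun g => hF'.measurableSet.const_smul g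
    have h1 : m (⋃ g ∈ I, g • F') = I.card * m F := by
      rw [measure_biUnion_finset hdisj fun g _ => hmeas g]
      simp [measure_smul,
        (hF'.isFundamentalDomain m).measure_eq (hF.isFundamentalDomain m)]
    have h2 : ∀ w, transportCost c ((q w).restrict (univ ×ˢ ⋃ g ∈ I, g • F')) =
        ∑ g ∈ I, transportCost c ((q w).restrict (univ ×ˢ (g • F'))) := by
      intro w
      simp only [transportCost]
      rw [prod_iUnion₂, lintegral_biUnion_finset _ fun g _ => MeasurableSet.univ.prod (hmeas g)]
      intro g hg h hh hgh
      exact disjoint_prod.2 (Or.inr (hdisj hg hh hgh))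
    have h3 : ∫⁻ w, transportCost c ((q w).restrict (univ ×ˢ ⋃ g ∈ I, g • F')) ∂P =
        I.card * expectedCost P c q F := by
      simp only [h2]
      rw [lintegral_finsetSum _ fun g _ => measurable_transportCost_restrict hc
        (MeasurableSet.univ.prod (hmeas g))]
      refine (Finset.sum_congr rfl fun g _ =>
        (hF'.smul g).expectedCost_eq hc hinv hq hF).trans ?_
      simp
    have hI0 : (I.card : ℝ≥0∞) ≠ 0 := by simpa using hI.ne_empty
    rw [h1, h3, ENNReal.mul_inv (Or.inl hI0) (Or.inl (ENNReal.natCast_ne_top _)),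
      mul_mul_mul_comm, ENNReal.inv_mul_cancel hI0 (ENNReal.natCast_ne_top _), one_mul]
  have hFadm : IsAdmissible G F := ⟨{1}, F, by simp, hF, by simp⟩
  refine le_antisymm (iSup₂_le fun B hB => (key B hB).le) ?_
  rw [← key F hFadm]
  exact le_iSup₂ (f := fun (B : Set M) (_ : IsAdmissible G B) =>
    (m B)⁻¹ * ∫⁻ w, transportCost c ((q w).restrict (univ ×ˢ B)) ∂P) F hFadm

end MeanCost

/-! ### Equivariant improvement of a random measure -/

section ExchangeKernel

variable {Ω X : Type*} [MeasurableSpace Ω] [MeasurableSpace X] {N : ℕ}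

/-- The random measure conditioned on the set `D`. -/
noncomputable def condKernelOn {Y : Type*} [MeasurableSpace Y] (q : Kernel Ω Y) {D : Set Y}
    (hD : MeasurableSet D) : Kernel Ω Y where
  toFun w := cond (q w) D
  measurable' := Measure.measurable_of_measurable_coe _ fun s hs => by
    simp only [cond_apply hD]
    exact (q.measurable_coe hD).inv.mul (q.measurable_coe (hD.inter hs))

theorem cond_univ_le_one {Y : Type*} [MeasurableSpace Y] (μ : Measure Y) {D : Set Y}
    (hD : MeasurableSet D) : (cond μ D) univ ≤ 1 := by
  rw [cond_apply hD, inter_univ]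
  exact ENNReal.inv_mul_le_one _

instance {Y : Type*} [MeasurableSpace Y] (q : Kernel Ω Y) {D : Set Y} (hD : MeasurableSet D) :
    IsFiniteKernel (condKernelOn q hD) :=
  ⟨⟨1, ENNReal.one_lt_top, fun _ => cond_univ_le_one _ hD⟩⟩

/-- The random version of `exchangeAdded`. -/
noncomputable def exchangeAddedKernel (q : Kernel Ω (X × X)) {U V : Fin (N + 1) → Set X}
    (h : ∀ i, MeasurableSet (U i ×ˢ V i)) (t : Ω → ℝ≥0∞) : Kernel Ω (X × X) :=
  (Kernel.sum fun i => (condKernelOn q (h i)).fst ×ₖ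
    (condKernelOn q (h (i + 1))).snd).withDensity fun w _ => t w

theorem exchangeAddedKernel_apply (q : Kernel Ω (X × X)) {U V : Fin (N + 1) → Set X}
    (h : ∀ i, MeasurableSet (U i ×ˢ V i)) {t : Ω → ℝ≥0∞} (ht : Measurable t) (w : Ω) :
    exchangeAddedKernel q h t w = exchangeAdded (q w) U V (t w) := by
  have ht' : Measurable (Function.uncurry fun (w : Ω) (_ : X × X) => t w) := ht.comp measurable_fst
  rw [exchangeAddedKernel, Kernel.withDensity_apply _ ht', withDensity_const, Kernel.sum_apply,
    Measure.sum_fintype, exchangeAdded]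
  simp only [Kernel.prod_apply, Kernel.fst_apply, Kernel.snd_apply]
  rfl

/-- The density of `exchangeRemoved`. -/
noncomputable def exchangeDensity (ν : Measure (X × X)) (U V : Fin (N + 1) → Set X) (t : ℝ≥0∞)
    (p : X × X) : ℝ≥0∞ :=
  ∑ i, (U i ×ˢ V i).indicator (fun _ => t * (ν (U i ×ˢ V i))⁻¹) p

theorem withDensity_exchangeDensity (ν : Measure (X × X)) {U V : Fin (N + 1) → Set X}
    (h : ∀ i, MeasurableSet (U i ×ˢ V i)) (t : ℝ≥0∞) :
    ν.withDensity (exchangeDensity ν U V t) = exchangeRemoved ν U V t := by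
  ext A hA
  rw [withDensity_apply _ hA]
  simp only [exchangeDensity, exchangeRemoved, Measure.smul_apply, Measure.finsetSum_apply,
    smul_eq_mul]
  rw [lintegral_finsetSum _ fun i _ => measurable_const.indicator (h i), Finset.mul_sum]
  refine Finset.sum_congr rfl fun i _ => ?_
  rw [lintegral_indicator_const (h i), Measure.restrict_apply (h i), cond_apply (h i), mul_assoc]

theorem measurable_exchangeDensity (q : Kernel Ω (X × X)) {U V : Fin (N + 1) → Set X}
    (h : ∀ i, MeasurableSet (U i ×ˢ V i)) {t : Ω → ℝ≥0∞} (ht : Measurable t) :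
    Measurable (Function.uncurry fun w p => exchangeDensity (q w) U V (t w) p) := by
  simp only [Function.uncurry_def, exchangeDensity]
  refine Finset.measurable_fun_sum _ fun i _ => ?_
  have h1 : Measurable fun z : Ω × (X × X) => t z.1 * (q z.1 (U i ×ˢ V i))⁻¹ :=
    (ht.mul (q.measurable_coe (h i)).inv).comp measurable_fst
  exact h1.indicator (measurable_snd (h i))

/-- The mass of each summand of the exchange that is used to improve a random measure. -/
noncomputable def exchangeMass (ν : Measure (X × X)) (U V : Fin (N + 1) → Set X) (L : ℝ≥0∞) :
    ℝ≥0∞ :=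
  (⨅ i, ν (U i ×ˢ V i)) * ((N + 1) * L)⁻¹

theorem measurable_exchangeMass (q : Kernel Ω (X × X)) {U V : Fin (N + 1) → Set X}
    (h : ∀ i, MeasurableSet (U i ×ˢ V i)) (L : ℝ≥0∞) :
    Measurable fun w => exchangeMass (q w) U V L :=
  (Measurable.iInf fun i => q.measurable_coe (h i)).mul_const _

/-- The infimum of the box masses makes each summand at most `((N + 1) * L)⁻¹`. If `K` meets every
orbit at most `L` times, the translates of the density therefore sum to at most one. -/
theorem exchangeDensity_le (ν : Measure (X × X)) {U V : Fin (N + 1) → Set X} {K : Set X}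
    (hK : ∀ i, U i ⊆ K) (L : ℝ≥0∞) (p : X × X) :
    exchangeDensity ν U V (exchangeMass ν U V L) p ≤ L⁻¹ * K.indicator (fun _ => 1) p.1 := by
  by_cases hp : p.1 ∈ K
  · rw [indicator_of_mem hp, mul_one]
    calc exchangeDensity ν U V (exchangeMass ν U V L) p
        ≤ ∑ _i : Fin (N + 1), ((N + 1) * L)⁻¹ := by
          refine Finset.sum_le_sum fun i _ => ?_
          refine (indicator_le_self' (fun _ _ => zero_le) p).trans ?_
          calc exchangeMass ν U V L * (ν (U i ×ˢ V i))⁻¹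
              ≤ ν (U i ×ˢ V i) * ((N + 1) * L)⁻¹ * (ν (U i ×ˢ V i))⁻¹ := by
                unfold exchangeMass
                gcongr
                exact iInf_le _ i
            _ = (ν (U i ×ˢ V i))⁻¹ * ν (U i ×ˢ V i) * ((N + 1) * L)⁻¹ := by ring
            _ ≤ 1 * ((N + 1) * L)⁻¹ := by gcongr; exact ENNReal.inv_mul_le_one _
            _ = _ := one_mul _
      _ = L⁻¹ := by
          have e1 : ((N : ℝ≥0∞) + 1) ≠ 0 := by simp
          have e2 : ((N : ℝ≥0∞) + 1) ≠ ⊤ := by simp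
          simp only [Finset.sum_const, Finset.card_univ, Fintype.card_fin, nsmul_eq_mul]
          push_cast
          rw [ENNReal.mul_inv (Or.inl e1) (Or.inl e2), ← mul_assoc, ENNReal.mul_inv_cancel e1 e2,
            one_mul]
  · refine (Finset.sum_eq_zero fun i _ => indicator_of_notMem (fun h => hp (hK i h.1)) _).trans_le
      (zero_le)

variable {ν : Measure (X × X)} {U V : Fin (N + 1) → Set X} {L : ℝ≥0∞}

/-- A null box switches the exchange off, so that marginals are preserved for every `w`, not only
where all boxes are charged. -/
theorem exchangeMass_eq_zero_or (ν : Measure (X × X)) (U V : Fin (N + 1) → Set X) (L : ℝ≥0∞) :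
    exchangeMass ν U V L = 0 ∨ ∀ i, ν (U i ×ˢ V i) ≠ 0 := by
  by_contra! h
  obtain ⟨h1, i, hi⟩ := h
  refine h1 ?_
  rw [exchangeMass, nonpos_iff_eq_zero.1 ((iInf_le _ i).trans_eq hi), zero_mul]

theorem exchangeMass_ne_zero (hL : L ≠ ⊤) (h : ∀ i, ν (U i ×ˢ V i) ≠ 0) :
    exchangeMass ν U V L ≠ 0 := by
  obtain ⟨i, hi⟩ := exists_eq_ciInf_of_finite (f := fun i => ν (U i ×ˢ V i))
  refine mul_ne_zero (hi ▸ h i) (ENNReal.inv_ne_zero.2 (ENNReal.mul_ne_top (by simp) hL))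

theorem exchangeMass_ne_top (hL : L ≠ 0) (h : ∀ i, ν (U i ×ˢ V i) ≠ ⊤) :
    exchangeMass ν U V L ≠ ⊤ := by
  obtain ⟨i, hi⟩ := exists_eq_ciInf_of_finite (f := fun i => ν (U i ×ˢ V i))
  refine ENNReal.mul_ne_top (hi ▸ h i) (ENNReal.inv_ne_top.2 (mul_ne_zero (by simp) hL))

theorem exchange_zero (ν : Measure (X × X)) (U V : Fin (N + 1) → Set X) :
    exchangeAdded ν U V 0 = 0 ∧ exchangeRemoved ν U V 0 = 0 := by
  simp [exchangeAdded, exchangeRemoved]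

theorem exchangeRemoved_eq_zero (h : ∀ i, MeasurableSet (U i ×ˢ V i)) (t : ℝ≥0∞)
    {A : Set (X × X)} (hA : ∀ i, Disjoint (U i ×ˢ V i) A) : exchangeRemoved ν U V t A = 0 := by
  simp [exchangeRemoved, cond_apply (h _), (hA _).inter_eq]

theorem exchangeAdded_univ_lt_top (h : ∀ i, MeasurableSet (U i ×ˢ V i)) {t : ℝ≥0∞} (ht : t ≠ ⊤) :
    exchangeAdded ν U V t univ < ⊤ := by
  have hf : ∀ i, IsFiniteMeasure (cond ν (U i ×ˢ V i)) := fun i =>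
    ⟨(cond_univ_le_one _ (h i)).trans_lt ENNReal.one_lt_top⟩
  simp only [exchangeAdded, Measure.smul_apply, Measure.finsetSum_apply, smul_eq_mul]
  exact ENNReal.mul_lt_top ht.lt_top (ENNReal.sum_lt_top.2 fun i _ => measure_lt_top _ _)

end ExchangeKernel

section Improvement

variable {G Ω M : Type*} [Group G] [Countable G] [MeasurableSpace Ω] [MulAction G Ω]
  [MeasurableConstSMul G Ω] [MeasurableSpace M] [MulAction G M] [MeasurableConstSMul G M]
  [MeasurableConstSMul G (M × M)]

theorem fst_translateSum_congr {κ η : Kernel Ω (M × M)} (h : ∀ w, (κ w).fst = (η w).fst) (w : Ω) :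
    (translateSum G κ w).fst = (translateSum G η w).fst := by
  simp only [translateSum_apply, Measure.fst_sum]
  congr 1
  ext1 g
  have key : ∀ μ : Measure (M × M), (μ.map fun p => g • p).fst = μ.fst.map fun x => g • x := by
    intro μ
    rw [Measure.fst, Measure.fst, Measure.map_map measurable_fst (measurable_const_smul g),
      Measure.map_map (measurable_const_smul g) measurable_fst]
    rfl
  rw [key, key, h]

theorem snd_translateSum_congr {κ η : Kernel Ω (M × M)} (h : ∀ w, (κ w).snd = (η w).snd) (w : Ω) :
    (translateSum G κ w).snd = (translateSum G η w).snd := by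
  simp only [translateSum_apply, Measure.snd_sum]
  congr 1
  ext1 g
  have key : ∀ μ : Measure (M × M), (μ.map fun p => g • p).snd = μ.snd.map fun x => g • x := by
    intro μ
    rw [Measure.snd, Measure.snd, Measure.map_map measurable_snd (measurable_const_smul g),
      Measure.map_map (measurable_const_smul g) measurable_snd]
    rfl
  rw [key, key, h]

end Improvement

section Improvement

variable {G Ω M : Type*} [Group G] [Countable G] [MeasurableSpace Ω] [MulAction G Ω]
  [MeasurableConstSMul G Ω] [MetricSpace M] [ProperSpace M] [MeasurableSpace M] [BorelSpace M]
  [MulAction G M] [IsIsometricSMul G M]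

/-- If a cyclic exchange of mass is possible with positive probability, then an equivariant random
measure can be replaced by a cheaper one with the same marginals. -/
theorem exists_expectedCost_lt (hdisc : IsProperlyDiscontinuous G M) {P : Measure Ω}
    [SMulInvariantMeasure G Ω P] {c : M → M → ℝ≥0} (hc : Continuous fun p : M × M => c p.1 p.2)
    (hinv : ∀ (g : G) x y, c (g • x) (g • y) = c x y) {q : Kernel Ω (M × M)}
    (hq : IsRandomMeasure q) (hqe : IsEquivariant G q) {F : Set M} (hF : IsFundamentalRegion G F)
    (hfin : expectedCost P c q F ≠ ⊤) {N : ℕ} {U V : Fin (N + 1) → Set M}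
    (hU : ∀ i, IsOpen (U i)) (hV : ∀ i, IsOpen (V i)) (hUb : ∀ i, Bornology.IsBounded (U i))
    (hVb : ∀ i, Bornology.IsBounded (V i)) (hUV : IsCyclicViolation c U V)
    (hpos : ∃ᶠ w in ae P, ∀ i, q w (U i ×ˢ V i) ≠ 0) :
    ∃ q' : Kernel Ω (M × M), IsRandomMeasure q' ∧ IsEquivariant G q' ∧
      (∀ w, (q' w).fst = (q w).fst ∧ (q' w).snd = (q w).snd) ∧
      expectedCost P c q' F < expectedCost P c q F := by
  have hcm : Measurable fun p : M × M => c p.1 p.2 := hc.measurable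
  have := isSFiniteKernel_of_isRandomMeasure hq
  set K : Set M := ⋃ i, closure (U i) with hKdef
  have hK : IsCompact K := isCompact_iUnion fun i => (hUb i).isCompact_closure
  have hUK : ∀ i, U i ⊆ K := fun i => subset_closure.trans (subset_iUnion (fun i => closure (U i)) i)
  obtain ⟨L, hL0, hL⟩ := hdisc.exists_tsum_indicator_le hK
  have hL0' : (L : ℝ≥0∞) ≠ 0 := by exact_mod_cast hL0.ne'
  have hUm : ∀ i, MeasurableSet (U i) := fun i => (hU i).measurableSet
  have hVm : ∀ i, MeasurableSet (V i) := fun i => (hV i).measurableSet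
  have hDm : ∀ i, MeasurableSet (U i ×ˢ V i) := fun i => (hUm i).prod (hVm i)
  have hDfin : ∀ w i, q w (U i ×ˢ V i) ≠ ⊤ := fun w i => by
    have := hq w
    exact ((measure_mono (Set.prod_mono subset_closure subset_closure)).trans_lt
      ((hUb i).isCompact_closure.prod (hVb i).isCompact_closure).measure_lt_top).ne
  set t : Ω → ℝ≥0∞ := fun w => exchangeMass (q w) U V L with ht
  have htm : Measurable t := measurable_exchangeMass q hDm L
  have httop : ∀ w, t w ≠ ⊤ := fun w => exchangeMass_ne_top hL0' (hDfin w)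
  set s : Ω → M × M → ℝ≥0∞ := fun w p => exchangeDensity (q w) U V (t w) p with hsdef
  have hsm : Measurable (Function.uncurry s) := measurable_exchangeDensity q hDm htm
  have hsle : ∀ w p, s w p ≤ (L : ℝ≥0∞)⁻¹ * K.indicator (fun _ => 1) p.1 := fun w p =>
    exchangeDensity_le (q w) hUK L p
  set R : Kernel Ω (M × M) := q.withDensity s with hR
  set A : Kernel Ω (M × M) := exchangeAddedKernel q hDm t with hA
  have hRw : ∀ w, R w = exchangeRemoved (q w) U V (t w) := fun w => by
    rw [hR, Kernel.withDensity_apply _ hsm]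
    exact withDensity_exchangeDensity _ hDm _
  have hAw : ∀ w, A w = exchangeAdded (q w) U V (t w) := exchangeAddedKernel_apply q hDm htm
  have : IsSFiniteKernel R := by
    refine Kernel.IsSFiniteKernel.withDensity q fun w p => ((hsle w p).trans_lt ?_).ne
    refine ENNReal.mul_lt_top (ENNReal.inv_lt_top.2 (pos_iff_ne_zero.2 hL0')) ?_
    exact (indicator_le (fun _ _ => le_rfl) _).trans_lt ENNReal.one_lt_top
  have : IsSFiniteKernel A := Kernel.IsSFiniteKernel.withDensity _ fun w _ => httop w
  have hmarg : ∀ w, (A w).fst = (R w).fst ∧ (A w).snd = (R w).snd := fun w => by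
    rw [hAw, hRw]
    rcases exchangeMass_eq_zero_or (q w) U V L with h | h
    · rw [show t w = 0 from h, (exchange_zero _ U V).1, (exchange_zero _ U V).2]
      exact ⟨rfl, rfl⟩
    · exact ⟨fst_exchangeAdded h (hDfin w), snd_exchangeAdded h (hDfin w)⟩
  set r : Ω → M × M → ℝ≥0∞ := fun w p => ∑' g : G, s (g⁻¹ • w) (g⁻¹ • p) with hr
  have hr1 : ∀ w p, r w p ≤ 1 := by
    intro w p
    calc r w p ≤ ∑' g : G, (L : ℝ≥0∞)⁻¹ * K.indicator (fun _ => 1) (g⁻¹ • p).1 :=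
          ENNReal.tsum_le_tsum fun g => hsle _ _
      _ = (L : ℝ≥0∞)⁻¹ * ∑' g : G, K.indicator (fun _ => 1) (g • p.1) := by
          rw [ENNReal.tsum_mul_left]
          congr 1
          exact (Equiv.inv G).tsum_eq fun g : G => K.indicator (fun _ => (1 : ℝ≥0∞)) (g • p.1)
      _ ≤ (L : ℝ≥0∞)⁻¹ * L := by gcongr; exact hL p.1
      _ ≤ 1 := ENNReal.inv_mul_le_one _
  obtain ⟨Q, hQe, hsplit⟩ := exists_add_translateSum_eq hqe hsm hr1
  refine ⟨Q + translateSum G A, fun w => ?_, ?_, fun w => ⟨?_, ?_⟩, ?_⟩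
  · have hqw := hq w
    refine ⟨fun p => ?_⟩
    obtain ⟨W, hW, hWfin⟩ := hqw.finiteAtNhds p
    have hK₁ := isCompact_closedBall p.1 1
    refine ⟨W ∩ Prod.fst ⁻¹' Metric.closedBall p.1 1, inter_mem hW
      (continuous_fst.continuousAt.preimage_mem_nhds (Metric.closedBall_mem_nhds _ one_pos)), ?_⟩
    rw [add_apply, Measure.add_apply]
    refine ENNReal.add_lt_top.2 ⟨?_, ?_⟩
    · refine lt_of_le_of_lt ((measure_mono inter_subset_left).trans ?_) hWfin
      have : Q w ≤ q w := by
        conv_rhs => rw [← hsplit, add_apply]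
        exact Measure.le_add_right le_rfl
      exact this _
    · refine lt_of_le_of_lt (measure_mono inter_subset_right) ?_
      have hK₁m : MeasurableSet (Metric.closedBall p.1 1) := hK₁.measurableSet
      -- The first marginal of the added measure equals that of the removed one and lives on `K`.
      -- Hence only finitely many translates reach first coordinates in `K₁`, each with finite mass.
      have hfinite := hdisc.finite_inter_nonempty (hK.union hK₁)
      rw [translateSum_apply, Measure.sum_apply _ (measurable_fst hK₁m),
        tsum_eq_sum (s := hfinite.toFinset)]
      · refine ENNReal.sum_lt_top.2 fun g _ => ?_
        rw [Measure.map_apply (measurable_const_smul g) (measurable_fst hK₁m), hAw]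
        exact (measure_mono (subset_univ _)).trans_lt (exchangeAdded_univ_lt_top hDm (httop _))
      · intro g hg
        have hB : MeasurableSet ((fun x : M => g • x) ⁻¹' Metric.closedBall p.1 1) :=
          measurable_const_smul g hK₁m
        rw [Measure.map_apply (measurable_const_smul g) (measurable_fst hK₁m)]
        change A (g⁻¹ • w) (Prod.fst ⁻¹' ((fun x : M => g • x) ⁻¹' Metric.closedBall p.1 1)) = 0
        rw [← Measure.fst_apply hB, (hmarg _).1, Measure.fst_apply hB, hRw]
        refine exchangeRemoved_eq_zero hDm _ fun i => disjoint_left.2 fun z hz hz' => hg ?_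
        rw [Set.Finite.mem_toFinset]
        exact ⟨g • z.1, ⟨z.1, Or.inl (hUK i hz.1), rfl⟩, Or.inr hz'⟩
  · exact hQe.add (isEquivariant_translateSum A)
  · rw [add_apply, Measure.fst_add, fst_translateSum_congr (fun w => (hmarg w).1),
      ← Measure.fst_add, ← add_apply, hsplit]
  · rw [add_apply, Measure.snd_add, snd_translateSum_congr (fun w => (hmarg w).2),
      ← Measure.snd_add, ← add_apply, hsplit]
  · have hcost : ∀ w, (∀ i, q w (U i ×ˢ V i) ≠ 0) →
        transportCost c (A w) < transportCost c (R w) := fun w h => by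
      rw [hAw, hRw]
      exact transportCost_exchangeAdded_lt hUV hUm hVm h (hDfin w)
        (exchangeMass_ne_zero (ENNReal.natCast_ne_top L) h) (httop w)
    have hcost' : ∀ w, transportCost c (A w) ≤ transportCost c (R w) := fun w => by
      rcases exchangeMass_eq_zero_or (q w) U V L with h | h
      · rw [hAw, hRw, show t w = 0 from h, (exchange_zero _ U V).1, (exchange_zero _ U V).2]
      · exact (hcost w h).le
    -- By the Campbell formula, it remains to compare the expected total costs of one removed and
    -- one added measure.
    have hEq : expectedCost P c q F =
        expectedCost P c Q F + ∫⁻ w, transportCost c (R w) ∂P := by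
      rw [← expectedCost_translateSum hcm hinv hF, ← expectedCost_add hcm _ _ hF.measurableSet,
        hsplit]
    rw [hEq] at hfin ⊢
    rw [expectedCost_add hcm _ _ hF.measurableSet, expectedCost_translateSum hcm hinv hF]
    have hRfin := (ENNReal.add_ne_top.1 hfin).2
    refine ENNReal.add_lt_add_left (ENNReal.add_ne_top.1 hfin).1 ?_
    refine lintegral_strict_mono_of_ae_le_of_frequently_ae_lt ?_
      (ne_top_of_le_ne_top hRfin (lintegral_mono hcost')) (ae_of_all _ hcost')
      (hpos.mono fun w h => (hcost w h).ne)
    exact ((Measure.measurable_lintegral hcm.coe_nnreal_ennreal).comp R.measurable).aemeasurable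

end Improvement

/-! ### Optimal semicouplings -/

section OptimalSemicoupling

variable {G Ω M : Type*} [Group G] [Countable G] [MeasurableSpace Ω] [MulAction G Ω]
  [MeasurableConstSMul G Ω] [MetricSpace M] [ProperSpace M] [MeasurableSpace M] [BorelSpace M]
  [MulAction G M] [IsIsometricSMul G M] {P : Measure Ω} [SMulInvariantMeasure G Ω P]
  {c : M → M → ℝ≥0} {m : Measure M} [SMulInvariantMeasure G M m] {lam mu : Kernel Ω M}
  {q : Kernel Ω (M × M)}

/-- Countability allows an almost sure statement over all boxes at once; boundedness gives boxes
finite mass and compact closure. -/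
theorem isTopologicalBasis_isBounded (X : Type*) [PseudoMetricSpace X]
    [SecondCountableTopology X] : TopologicalSpace.IsTopologicalBasis
      {U ∈ TopologicalSpace.countableBasis X | Bornology.IsBounded U} := by
  refine TopologicalSpace.isTopologicalBasis_of_isOpen_of_nhds
    (fun U hU => TopologicalSpace.isOpen_of_mem_countableBasis hU.1) fun x U hx hU => ?_
  obtain ⟨W, hW, hxW, hWU⟩ := (TopologicalSpace.isBasis_countableBasis X).mem_nhds_iff.1
    (inter_mem (hU.mem_nhds hx) (Metric.ball_mem_nhds x one_pos))
  exact ⟨W, ⟨hW, Metric.isBounded_ball.subset (hWU.trans inter_subset_right)⟩, hxW,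
    hWU.trans inter_subset_left⟩

/-- The support of an optimal semicoupling is almost surely cyclically monotone. -/
theorem IsOptimalSemicoupling.ae_isCyclicallyMonotone_support
    (hdisc : IsProperlyDiscontinuous G M) (hc : Continuous fun p : M × M => c p.1 p.2)
    (hinv : ∀ (g : G) x y, c (g • x) (g • y) = c x y)
    (hq : IsOptimalSemicoupling G P m c lam mu q) {F : Set M} (hF : IsFundamentalRegion G F)
    (hm0 : m F ≠ 0) (hm1 : m F ≠ ⊤) (hfin : expectedCost P c q F ≠ ⊤) :
    ∀ᵐ w ∂P, IsCyclicallyMonotone c (q w).support := by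
  have hcm : Measurable fun p : M × M => c p.1 p.2 := hc.measurable
  set b := {U ∈ TopologicalSpace.countableBasis M | Bornology.IsBounded U} with hb
  have : Countable b := ((TopologicalSpace.countable_countableBasis M).mono fun U hU => hU.1)
  have key : ∀ (N : ℕ) (U V : Fin (N + 1) → b),
      IsCyclicViolation c (fun i => (U i : Set M)) (fun i => (V i : Set M)) →
      ∀ᵐ w ∂P, ¬ ∀ i, q w ((U i : Set M) ×ˢ (V i : Set M)) ≠ 0 := by
    intro N U V hUV
    -- The negated statement is definitionally the `∃ᶠ` hypothesis of `exists_expectedCost_lt`.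
    by_contra hpos
    obtain ⟨q', hq'r, hq'e, hmarg, hlt⟩ := exists_expectedCost_lt hdisc hc hinv
      hq.isEquivariantSemicoupling.isRandomMeasure hq.isEquivariantSemicoupling.isEquivariant hF
      hfin (fun i => TopologicalSpace.isOpen_of_mem_countableBasis (U i).2.1)
      (fun i => TopologicalSpace.isOpen_of_mem_countableBasis (V i).2.1) (fun i => (U i).2.2)
      (fun i => (V i).2.2) hUV hpos
    have hsemi : IsEquivariantSemicoupling G P lam mu q' := by
      refine ⟨hq'r, ?_, hq'e⟩
      filter_upwards [hq.isEquivariantSemicoupling.isSemicoupling] with w hw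
      rwa [IsSemicoupling, (hmarg w).1, (hmarg w).2]
    have := isSFiniteKernel_of_isRandomMeasure hq'r
    have := isSFiniteKernel_of_isRandomMeasure hq.isEquivariantSemicoupling.isRandomMeasure
    have h1 : meanTransportCost G P m c q ≤ meanTransportCost G P m c q' := by
      rw [hq.asymptotically_optimal]
      exact iInf₂_le q' hsemi
    rw [meanTransportCost_eq hcm hinv hq.isEquivariantSemicoupling.isEquivariant hF,
      meanTransportCost_eq hcm hinv hq'e hF] at h1
    exact h1.not_gt ((ENNReal.mul_lt_mul_iff_right (ENNReal.inv_ne_zero.2 hm1)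
      (ENNReal.inv_ne_top.2 hm0)).2 hlt)
  have hall : ∀ᵐ w ∂P, ∀ (N : ℕ) (U V : Fin (N + 1) → b),
      IsCyclicViolation c (fun i => (U i : Set M)) (fun i => (V i : Set M)) →
      ¬ ∀ i, q w ((U i : Set M) ×ˢ (V i : Set M)) ≠ 0 :=
    ae_all_iff.2 fun N => ae_all_iff.2 fun U => ae_all_iff.2 fun V => ae_all_iff.2 (key N U V)
  filter_upwards [hall] with w hw
  by_contra hS
  obtain ⟨N, z, U, V, hz, hzUV, hviol⟩ :=
    exists_isCyclicViolation hc (isTopologicalBasis_isBounded M) hS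
  refine hw N (fun i => ⟨U i, (hzUV i).1⟩) (fun i => ⟨V i, (hzUV i).2.1⟩) hviol fun i => ?_
  exact ((Measure.mem_support_iff_forall _).1 (hz i) _
    (((TopologicalSpace.isOpen_of_mem_countableBasis (hzUV i).1.1).prod
      (TopologicalSpace.isOpen_of_mem_countableBasis (hzUV i).2.1.1)).mem_nhds
        (hzUV i).2.2)).ne'

/-- A ball meets orbits boundedly often, so its expected cost is at most a multiple of that of `F`.
Countably many balls exhaust the compact sets. -/
theorem ae_transportCost_restrict_ne_top [Nonempty M] (hdisc : IsProperlyDiscontinuous G M)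
    (hc : Continuous fun p : M × M => c p.1 p.2)
    (hinv : ∀ (g : G) x y, c (g • x) (g • y) = c x y) (hq : IsRandomMeasure q)
    (hqe : IsEquivariant G q) {F : Set M} (hF : IsFundamentalRegion G F)
    (hfin : expectedCost P c q F ≠ ⊤) :
    ∀ᵐ w ∂P, ∀ A : Set M, IsCompact A → transportCost c ((q w).restrict (univ ×ˢ A)) ≠ ⊤ := by
  obtain ⟨x₀⟩ := ‹Nonempty M›
  have := isSFiniteKernel_of_isRandomMeasure hq
  have key : ∀ k : ℕ, ∀ᵐ w ∂P,
      transportCost c ((q w).restrict (univ ×ˢ Metric.closedBall x₀ k)) < ⊤ := by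
    intro k
    obtain ⟨L, -, hL⟩ := hdisc.exists_tsum_indicator_le (isCompact_closedBall x₀ k)
    have hB : MeasurableSet (Metric.closedBall x₀ k) := measurableSet_closedBall
    refine ae_lt_top (measurable_transportCost_restrict hc.measurable
      (MeasurableSet.univ.prod hB)) (ne_top_of_le_ne_top ?_
      (expectedCost_le_of_tsum_indicator_le (P := P) hc.measurable hinv hqe hF hB hL))
    exact ENNReal.mul_ne_top (ENNReal.natCast_ne_top L) hfin
  filter_upwards [ae_all_iff.2 key] with w hw A hA
  obtain ⟨R, hR⟩ := hA.isBounded.subset_closedBall x₀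
  obtain ⟨k, hk⟩ := exists_nat_ge R
  refine ne_top_of_le_ne_top (hw k).ne (lintegral_mono' (Measure.restrict_mono
    (prod_mono_right (hR.trans (Metric.closedBall_subset_closedBall hk))) le_rfl) le_rfl)

end OptimalSemicoupling

/-- The measure `μHE[n]` is the Riemannian volume: the `n`-dimensional Hausdorff measure of the
Riemannian distance, normalized so that it is Lebesgue measure on Euclidean `n`-space. -/
theorem mainTheorem5 {n : ℕ} {M G Ω : Type*}
    -- a complete connected non-compact smooth Riemannian manifold
    [MetricSpace M] [ChartedSpace (EuclideanSpace ℝ (Fin n)) M] [IsManifold (𝓡 n) ∞ M]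
    [RiemannianBundle (fun x : M => TangentSpace (𝓡 n) x)]
    [IsContMDiffRiemannianBundle (𝓡 n) ∞ (EuclideanSpace ℝ (Fin n))
      (fun x : M => TangentSpace (𝓡 n) x)]
    [IsRiemannianManifold (𝓡 n) M]
    [SecondCountableTopology M] [CompleteSpace M] [ConnectedSpace M] [NoncompactSpace M]
    [MeasurableSpace M] [BorelSpace M]
    -- a group of isometries
    [Group G] [MulAction G M] [IsIsometricSMul G M]
    (hdisc : IsProperlyDiscontinuous G M) (hcocompact : IsCocompactAction G M)
    (hfree : IsFreeAction G M)
    -- the cost function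
    (ϑ : ℝ≥0 → ℝ≥0) (hϑ_mono : StrictMono ϑ) (hϑ_cont : Continuous ϑ) (hϑ_zero : ϑ 0 = 0)
    (hϑ_top : Tendsto ϑ atTop atTop)
    (hMonge : MongeUniquelySolvable (μHE[n] : Measure M) (fun x y => ϑ (nndist x y)))
    -- a probability space with a measurable flow that preserves the probability measure
    [MeasurableSpace Ω] (P : Measure Ω) [IsProbabilityMeasure P]
    [MulAction G Ω] [MeasurableConstSMul G Ω] [SMulInvariantMeasure G Ω P]
    -- two equivariant random measures of unit and subunit intensity
    (lam mu : Kernel Ω M) (hlam : IsRandomMeasure lam) (hmu : IsRandomMeasure mu)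
    (hlam_equiv : IsEquivariant G lam) (hmu_equiv : IsEquivariant G mu)
    (hlam_ac : ∀ᵐ w ∂P, lam w ≪ (μHE[n] : Measure M))
    (B₀ : Set M) (hB₀ : IsFundamentalRegion G B₀)
    (hlam_intensity : ∫⁻ w, lam w B₀ ∂P = (μHE[n] : Measure M) B₀)
    (hmu_intensity : ∫⁻ w, mu w B₀ ∂P ≤ (μHE[n] : Measure M) B₀)
    (hfinite : optimalMeanTransportCost G P (μHE[n] : Measure M)
      (fun x y => ϑ (nndist x y)) lam mu < ⊤)
    -- an optimal semicoupling
    (q : Kernel Ω (M × M))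
    (hq : IsOptimalSemicoupling G P (μHE[n] : Measure M) (fun x y => ϑ (nndist x y)) lam mu q) :
    IsLocallyOptimal P (fun x y => ϑ (nndist x y)) lam mu q := by
  have hloc : IsLocallyFiniteMeasure (μHE[n] : Measure M) :=
    isLocallyFiniteMeasure_euclideanHausdorffMeasure
  have : LocallyCompactSpace M := ChartedSpace.locallyCompactSpace (EuclideanSpace ℝ (Fin n)) M
  have : ProperSpace M := by
    obtain ⟨r, hr, hball⟩ := exists_isCompact_closedBall_of_isCocompactAction hcocompact
    exact properSpace_of_isCompact_closedBall hr hball fun x y s ε =>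
      exists_dist_eq_of_isRiemannianManifold (n := n) x y
  have : Countable G := hdisc.countable
  have : SMulInvariantMeasure G M (μHE[n] : Measure M) := by
    rw [Measure.euclideanHausdorffMeasure_def]
    infer_instance
  have hc : Continuous fun p : M × M => ϑ (nndist p.1 p.2) := hϑ_cont.comp continuous_nndist
  have hinv : ∀ (g : G) (x y : M), ϑ (nndist (g • x) (g • y)) = ϑ (nndist x y) := by simp
  have hsemi := hq.isEquivariantSemicoupling
  have := isSFiniteKernel_of_isRandomMeasure hsemi.isRandomMeasure
  obtain ⟨K, hK, hcov⟩ := exists_isCompact_iUnion_smul_eq_univ (G := G) (M := M) hcocompact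
  have hm1 : (μHE[n] : Measure M) B₀ ≠ ⊤ := (hB₀.measure_lt_top hK hcov).ne
  have hcyc : ∀ᵐ w ∂P, IsCyclicallyMonotone (fun x y => ϑ (nndist x y)) (q w).support ∧
      ∀ A : Set M, IsCompact A →
        transportCost (fun x y => ϑ (nndist x y)) ((q w).restrict (univ ×ˢ A)) ≠ ⊤ := by
    -- The strict comparison of mean costs divides by the volume of `B₀`. If that volume is zero, so
    -- is the whole measure, and absolute continuity leaves only `q w = 0`.
    rcases eq_or_ne ((μHE[n] : Measure M) B₀) 0 with hm0 | hm0
    · have hzero : (μHE[n] : Measure M) = 0 := by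
        by_contra h
        exact (hB₀.isFundamentalDomain _).measure_ne_zero h hm0
      filter_upwards [hlam_ac, hsemi.isSemicoupling] with w hw hw'
      rw [hzero, Measure.absolutelyContinuous_zero_iff] at hw
      have hqw : q w = 0 := by
        rw [← Measure.measure_univ_eq_zero, ← Measure.fst_univ]
        exact nonpos_iff_eq_zero.1 ((hw'.1 univ).trans_eq (by rw [hw]; rfl))
      rw [hqw]
      refine ⟨fun N z hz => ?_, fun A _ => by simp [transportCost]⟩
      simpa using hz 0
    · have hfin : expectedCost P (fun x y => ϑ (nndist x y)) q B₀ ≠ ⊤ := by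
        intro h
        rw [← hq.asymptotically_optimal,
          meanTransportCost_eq hc.measurable hinv hsemi.isEquivariant hB₀, h,
          ENNReal.mul_top (ENNReal.inv_ne_zero.2 hm1)] at hfinite
        exact lt_irrefl _ hfinite
      exact (hq.ae_isCyclicallyMonotone_support hdisc hc hinv hB₀ hm0 hm1 hfin).and
        (ae_transportCost_restrict_ne_top hdisc hc hinv hsemi.isRandomMeasure
          hsemi.isEquivariant hB₀ hfin)
  filter_upwards [hcyc, hlam_ac, hsemi.isSemicoupling] with w hw hac hsw
  have := hlam w
  have := hmu w
  have := hsemi.isRandomMeasure w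
  exact isLocallyOptimalAt_of_isCyclicallyMonotone hMonge hc hsw hac hw.1 hw.2
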